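/- Let $n\ge 2$, let $\eta=\mathrm{diag}(-1,1,\dots,1)$ be the Minkowski metric on $\mathbb R^{n+1}$, and let $g=(g_{\alpha\beta})$ be a smooth Lorentzian metric (signature $(-,+,\dots,+)$) defined on an open neighbourhood of the origin $O$ of $\mathbb R^{n+1}$. Assume that, near $O$, the light-cone $C_O$ of $O$ (the union of the null geodesics of $g$ issued from $O$, to the future and to the past) is given by $C_O=\{x:\ \eta_{\mu\nu}x^\mu x^\nu=0\}$; precisely, there is an open neighbourhood $W$ of $O$ such that the set of end points of the null $g$-geodesic segments in $W$ starting at $O$ is $\{x\in W:\ \eta_{\mu\nu}x^\mu x^\nu=0\}$. Assume moreover that $g_{\alpha\beta}-\eta_{\alpha\beta}=O(|x|^2)$ as $x\to0$. Then for every $\ell\in\mathbb N\cup\{\infty\}$ there exist an open neighbourhood $V$ of $O$, a smooth Lorentzian metric $\hat g$ on $V$ and smooth functions $P_\mu$ on $V$ such that $\hat g_{\mu\nu}=g_{\mu\nu}$ at all points $x\in V$ with $\eta_{\alpha\beta}x^\alpha x^\beta=0$, and such that the Ricci tensor $\hat R_{\mu\nu}$ of $\hat g$ satisfies, as $x\to0$,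 $$\hat R_{\mu\nu}=O(|x|^{\min(\ell,2)}),\qquad \hat R_{\mu\nu}x^\nu=O(|x|^{\ell+1})+P_\mu\,\eta_{\alpha\beta}x^\alpha x^\beta .$$ Here $O(|x|^\infty)$ means $O(|x|^N)$ for every $N\in\mathbb N$. -/

import Mathlib

open scoped ContDiff Asymptotics

noncomputable section

/-- The Minkowski metric `η = diag(-1, 1, …, 1)` on `ℝ^{n+1}`. -/
def minkowski (n : ℕ) : Matrix (Fin (n + 1)) (Fin (n + 1)) ℝ :=
  Matrix.diagonal (Fin.cons (-1) fun _ => 1)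

/-- The Minkowskian quadratic form `η_{αβ} x^α x^β`. -/
def minkowskiForm {n : ℕ} (x : Fin (n + 1) → ℝ) : ℝ :=
  ∑ α, ∑ β, minkowski n α β * x α * x β

/-- A matrix is the matrix of a symmetric bilinear form of signature `(-,+,…,+)`: it is congruent
to the Minkowski metric. -/
def IsLorentzianMatrix {n : ℕ} (M : Matrix (Fin (n + 1)) (Fin (n + 1)) ℝ) : Prop :=
  ∃ B : Matrix (Fin (n + 1)) (Fin (n + 1)) ℝ,
    IsUnit B.det ∧ B.transpose * M * B = minkowski n

/-- `g`, given by its components `g_{μν}` in the standard coordinates of `ℝ^{n+1}`, is a smooth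
Lorentzian metric on `U`. -/
structure IsSmoothLorentzianMetricOn {n : ℕ}
    (g : (Fin (n + 1) → ℝ) → Matrix (Fin (n + 1)) (Fin (n + 1)) ℝ)
    (U : Set (Fin (n + 1) → ℝ)) : Prop where
  smooth : ∀ μ ν, ContDiffOn ℝ ∞ (fun x => g x μ ν) U
  lorentzian : ∀ x ∈ U, IsLorentzianMatrix (g x)

/-- The coordinate derivative `∂_μ f`. -/
def partialDeriv {n : ℕ} (μ : Fin (n + 1)) (f : (Fin (n + 1) → ℝ) → ℝ)
    (x : Fin (n + 1) → ℝ) : ℝ :=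
  fderiv ℝ f x (Pi.single μ 1)

/-- The Christoffel symbols
`Γ^l_{μν} = ½ g^{lσ} (∂_μ g_{νσ} + ∂_ν g_{μσ} - ∂_σ g_{μν})` of the metric `g`. -/
def christoffel {n : ℕ} (g : (Fin (n + 1) → ℝ) → Matrix (Fin (n + 1)) (Fin (n + 1)) ℝ)
    (l μ ν : Fin (n + 1)) (x : Fin (n + 1) → ℝ) : ℝ :=
  (1 / 2 : ℝ) * ∑ σ, (g x)⁻¹ l σ *
    (partialDeriv μ (fun y => g y ν σ) x + partialDeriv ν (fun y => g y μ σ) x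
      - partialDeriv σ (fun y => g y μ ν) x)

/-- The Ricci tensor
`R_{μν} = ∂_l Γ^l_{μν} - ∂_ν Γ^l_{μl} + Γ^l_{lσ} Γ^σ_{μν} - Γ^l_{νσ} Γ^σ_{μl}` of `g`. -/
def ricci {n : ℕ} (g : (Fin (n + 1) → ℝ) → Matrix (Fin (n + 1)) (Fin (n + 1)) ℝ)
    (μ ν : Fin (n + 1)) (x : Fin (n + 1) → ℝ) : ℝ :=
  (∑ l, partialDeriv l (christoffel g l μ ν) x) - (∑ l, partialDeriv ν (christoffel g l μ l) x)
    + (∑ l, ∑ σ, christoffel g l l σ x * christoffel g σ μ ν x)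
    - ∑ l, ∑ σ, christoffel g l ν σ x * christoffel g σ μ l x

/-- The light-cone of `g` in `W`, with vertex at the origin: the set of end points of the geodesic
segments `γ : [0,1] → W` (with velocity `v`) which start at the origin in a null direction. Both
the future and the past part of the cone, and the vertex, are included. -/
def lightConeIn {n : ℕ} (g : (Fin (n + 1) → ℝ) → Matrix (Fin (n + 1)) (Fin (n + 1)) ℝ)
    (W : Set (Fin (n + 1) → ℝ)) : Set (Fin (n + 1) → ℝ) :=
  {x | ∃ γ v : ℝ → Fin (n + 1) → ℝ,
    (∀ t ∈ Set.Icc (0 : ℝ) 1, γ t ∈ W ∧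
      HasDerivWithinAt γ (v t) (Set.Icc 0 1) t ∧
      HasDerivWithinAt v (fun μ => -∑ α, ∑ β, christoffel g μ α β (γ t) * v t α * v t β)
        (Set.Icc 0 1) t) ∧
    γ 0 = 0 ∧ (∑ α, ∑ β, g 0 α β * v 0 α * v 0 β) = 0 ∧ γ 1 = x}

/-- `f = O(|x|^k)` as `x → 0`, where `k = ∞` is allowed and means `f = O(|x|^N)` for every `N`.
(All norms on `ℝ^{n+1}` are equivalent, so they give the same notion.) -/
def IsBigOOrder {n : ℕ} (k : ℕ∞) (f : (Fin (n + 1) → ℝ) → ℝ) : Prop :=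
  ∀ N : ℕ, (N : ℕ∞) ≤ k → f =O[nhds 0] fun x => ‖x‖ ^ N

end

open Filter Topology

noncomputable section

/-! Write `Q = η_{αβ} x^α x^β` and look for `ĝ = g + Q h` with `h` symmetric and smooth; such a
metric agrees with `g` on the cone whatever `h` is. The Taylor expansion of `h` is built degree by
degree so as to cancel `R̂_{μν} x^ν` modulo `Q`.

Since `g - η` vanishes to second order, a perturbation `γ` vanishing to order `k + 2` changes the
Ricci tensor by the Minkowskian linearized Ricci tensor of `γ`, up to terms of order `k + 2`
(`IsNearFlat.ricci_sub`). With `γ = Q h` and `h` homogeneous of degree `k`, the part of degree `k +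
1` of `R̂_{μν} x^ν` is therefore governed by a linear equation. By Euler's identity that equation
becomes algebraic modulo `Q`, apart from gradient and divergence terms which contraction with `x`
controls (`con_linRicci_Q_mul`). It is solvable in every degree `k > 0` because `n ≥ 2`
(`exists_con_linRicci_eq`); for `k = 0` a constant `h` removes the whole Ricci tensor at the origin
(`exists_linRicci_eq_const`). Borel's lemma sums the resulting series for `h` and `P`, and the error
is then flat at the origin, which settles all `ℓ` at once.

The bound on `R̂_{μν}` itself follows from the contracted one. The constant part `r` satisfies
`r_{μν} x^ν = 0`, so it vanishes. The linear part `T` satisfies `T_{μν} x^ν = c_μ Q`; symmetry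
expresses `T` through the constants `c_μ`, and the linearized Bianchi identity forces `c = 0`
(`IsNearFlat.vanishesToOrder_two_ricci`). -/

/-! ### Functions vanishing to a given order at the origin -/

/-- `f` is smooth at the origin and its derivatives of order `< m` vanish there. -/
def VanishesToOrder {n : ℕ} : ℕ → ((Fin (n + 1) → ℝ) → ℝ) → Prop
  | 0, f => ContDiffAt ℝ ∞ f 0
  | m + 1, f => ContDiffAt ℝ ∞ f 0 ∧ f 0 = 0 ∧ ∀ μ, VanishesToOrder m (partialDeriv μ f)

section Germs

variable {n : ℕ} {f f' : (Fin (n + 1) → ℝ) → ℝ} {m k : ℕ}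

theorem ContDiffAt.partialDeriv {x : Fin (n + 1) → ℝ} (hf : ContDiffAt ℝ ∞ f x)
    (μ : Fin (n + 1)) : ContDiffAt ℝ ∞ (partialDeriv μ f) x :=
  (hf.fderiv_right (m := ∞) (by simp)).clm_apply contDiffAt_const

theorem ContDiffAt.eventually_differentiableAt (hf : ContDiffAt ℝ ∞ f 0) :
    ∀ᶠ x in 𝓝 0, DifferentiableAt ℝ f x := by
  have h1 : ContDiffAt ℝ 1 f 0 := hf.of_le (by exact_mod_cast le_top)
  filter_upwards [h1.eventually (by simp)] with x hx
  exact hx.differentiableAt (by simp)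

theorem Filter.EventuallyEq.partialDeriv (h : f =ᶠ[𝓝 0] f') (μ : Fin (n + 1)) :
    partialDeriv μ f =ᶠ[𝓝 0] partialDeriv μ f' := by
  filter_upwards [h.fderiv (𝕜 := ℝ)] with x hx
  simp [_root_.partialDeriv, hx]

theorem partialDeriv_add (μ : Fin (n + 1)) (hf : ContDiffAt ℝ ∞ f 0)
    (hf' : ContDiffAt ℝ ∞ f' 0) :
    partialDeriv μ (fun x => f x + f' x) =ᶠ[𝓝 0]
      fun x => partialDeriv μ f x + partialDeriv μ f' x := by
  filter_upwards [hf.eventually_differentiableAt, hf'.eventually_differentiableAt] with x h h'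
  simp [partialDeriv, fderiv_fun_add h h']

theorem partialDeriv_sub (μ : Fin (n + 1)) (hf : ContDiffAt ℝ ∞ f 0)
    (hf' : ContDiffAt ℝ ∞ f' 0) :
    partialDeriv μ (fun x => f x - f' x) =ᶠ[𝓝 0]
      fun x => partialDeriv μ f x - partialDeriv μ f' x := by
  filter_upwards [hf.eventually_differentiableAt, hf'.eventually_differentiableAt] with x h h'
  simp [partialDeriv, fderiv_fun_sub h h']

theorem partialDeriv_comm_of_contDiffAt {x : Fin (n + 1) → ℝ} (hf : ContDiffAt ℝ 2 f x)
    (μ ν : Fin (n + 1)) :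
    partialDeriv μ (partialDeriv ν f) x = partialDeriv ν (partialDeriv μ f) x := by
  have hd : DifferentiableAt ℝ (fderiv ℝ f) x :=
    (hf.fderiv_right (m := 1) (by norm_num)).differentiableAt (by simp)
  have h (a b : Fin (n + 1)) : partialDeriv a (partialDeriv b f) x =
      fderiv ℝ (fderiv ℝ f) x (Pi.single a 1) (Pi.single b 1) := by
    change fderiv ℝ (fun y => fderiv ℝ f y (Pi.single b 1)) x (Pi.single a 1) = _
    rw [fderiv_clm_apply hd (by fun_prop)]
    simp
  rw [h, h, (hf.isSymmSndFDerivAt (by simp)).eq]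

theorem partialDeriv_comm (hf : ContDiffAt ℝ ∞ f 0) (μ ν : Fin (n + 1)) :
    partialDeriv μ (partialDeriv ν f) =ᶠ[𝓝 0] partialDeriv ν (partialDeriv μ f) := by
  have h2 : ContDiffAt ℝ 2 f 0 := contDiffAt_infty.1 hf 2
  filter_upwards [h2.eventually (by simp)] with x hx
  exact partialDeriv_comm_of_contDiffAt hx μ ν

theorem partialDeriv_mul (μ : Fin (n + 1)) (hf : ContDiffAt ℝ ∞ f 0)
    (hf' : ContDiffAt ℝ ∞ f' 0) :
    partialDeriv μ (fun x => f x * f' x) =ᶠ[𝓝 0]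
      fun x => partialDeriv μ f x * f' x + f x * partialDeriv μ f' x := by
  filter_upwards [hf.eventually_differentiableAt, hf'.eventually_differentiableAt] with x h h'
  simp [partialDeriv, fderiv_fun_mul h h']
  ring

theorem partialDeriv_const (μ : Fin (n + 1)) (c : ℝ) :
    partialDeriv μ (fun _ : Fin (n + 1) → ℝ => c) = fun _ => 0 := by
  funext x
  simp [partialDeriv]

namespace VanishesToOrder

theorem contDiffAt (h : VanishesToOrder m f) : ContDiffAt ℝ ∞ f 0 := by
  cases m with
  | zero => exact h
  | succ m => exact h.1

theorem eq_zero (h : VanishesToOrder (m + 1) f) : f 0 = 0 := h.2.1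

theorem partialDeriv (h : VanishesToOrder (m + 1) f) (μ : Fin (n + 1)) :
    VanishesToOrder m (partialDeriv μ f) := h.2.2 μ

theorem of_succ (h : VanishesToOrder (m + 1) f) : VanishesToOrder m f := by
  induction m generalizing f with
  | zero => exact h.1
  | succ m ih => exact ⟨h.1, h.2.1, fun μ => ih (h.2.2 μ)⟩

theorem mono (h : VanishesToOrder m f) (hk : k ≤ m) : VanishesToOrder k f := by
  induction hk with
  | refl => exact h
  | step _ ih => exact ih h.of_succ

theorem congr (h : VanishesToOrder m f) (hf : f =ᶠ[𝓝 0] f') : VanishesToOrder m f' := by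
  induction m generalizing f f' with
  | zero => exact ContDiffAt.congr_of_eventuallyEq h hf.symm
  | succ m ih =>
    exact ⟨h.1.congr_of_eventuallyEq hf.symm, hf.eq_of_nhds ▸ h.2.1,
      fun μ => ih (h.2.2 μ) (hf.partialDeriv μ)⟩

theorem zero (m : ℕ) : VanishesToOrder m (fun _ : Fin (n + 1) → ℝ => (0 : ℝ)) := by
  induction m with
  | zero => exact contDiffAt_const
  | succ m ih => exact ⟨contDiffAt_const, rfl, fun μ => by rwa [partialDeriv_const]⟩

theorem add (h : VanishesToOrder m f) (h' : VanishesToOrder m f') :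
    VanishesToOrder m (fun x => f x + f' x) := by
  induction m generalizing f f' with
  | zero => exact ContDiffAt.add h h'
  | succ m ih =>
    exact ⟨h.1.add h'.1, by simp [h.2.1, h'.2.1], fun μ =>
      (ih (h.2.2 μ) (h'.2.2 μ)).congr (partialDeriv_add μ h.1 h'.1).symm⟩

/-- Leibniz rule and induction on the total order `m + k`: each of the two terms of the derivative
loses one order in one factor only. A factor of order `0` loses nothing, and then the other factor
is weakened by one. -/
theorem mul (h : VanishesToOrder m f) (h' : VanishesToOrder k f') :
    VanishesToOrder (m + k) (fun x => f x * f' x) := by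
  induction hs : m + k generalizing m k f f' with
  | zero => exact h.contDiffAt.mul h'.contDiffAt
  | succ s ih =>
    refine ⟨h.contDiffAt.mul h'.contDiffAt, ?_, fun μ => congr (add ?_ ?_)
      (partialDeriv_mul μ h.contDiffAt h'.contDiffAt).symm⟩
    · rcases m with _ | m
      · rcases k with _ | k
        · omega
        · simp [h'.eq_zero]
      · simp [h.eq_zero]
    · rcases m with _ | m
      · exact ih (m := 0) (k := s) (h.contDiffAt.partialDeriv μ) (h'.mono (by omega)) (by omega)
      · exact ih (h.partialDeriv μ) h' (by omega)
    · rcases k with _ | k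
      · exact ih (m := s) (k := 0) (h.mono (by omega)) (h'.contDiffAt.partialDeriv μ) (by omega)
      · exact ih h (h'.partialDeriv μ) (by omega)

theorem mul_left (h' : VanishesToOrder k f') (h : ContDiffAt ℝ ∞ f 0) :
    VanishesToOrder k (fun x => f x * f' x) :=
  (mul (m := 0) h h').mono (by omega)

theorem const_mul (c : ℝ) (h : VanishesToOrder m f) : VanishesToOrder m (fun x => c * f x) :=
  h.mul_left contDiffAt_const

theorem neg (h : VanishesToOrder m f) : VanishesToOrder m (fun x => -f x) :=
  (h.const_mul (-1)).congr (.of_forall fun x => by simp)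

theorem sub (h : VanishesToOrder m f) (h' : VanishesToOrder m f') :
    VanishesToOrder m (fun x => f x - f' x) :=
  (h.add h'.neg).congr (.of_forall fun x => by simp [sub_eq_add_neg])

theorem sum {ι : Type*} {s : Finset ι} {F : ι → (Fin (n + 1) → ℝ) → ℝ}
    (h : ∀ i ∈ s, VanishesToOrder m (F i)) : VanishesToOrder m (fun x => ∑ i ∈ s, F i x) := by
  classical
  induction s using Finset.induction_on with
  | empty => simpa using zero m
  | insert a s ha ih =>
    refine ((h a (by simp)).add (ih fun i hi => h i (by simp [hi]))).congr (.of_forall fun x => ?_)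
    simp [Finset.sum_insert ha]

/-- The bounds on the partial derivatives control `fderiv` on the ball of radius `‖x‖`, and the mean
value inequality gains one power of `‖x‖`. -/
theorem isBigO (h : VanishesToOrder m f) : f =O[𝓝 0] fun x => ‖x‖ ^ m := by
  induction m generalizing f with
  | zero => simpa using h.contDiffAt.continuousAt.norm.isBoundedUnder_le.isBigO_one ℝ
  | succ m ih =>
    choose C hC using fun μ => (ih (h.partialDeriv μ)).bound
    have hev : ∀ᶠ x in 𝓝 (0 : Fin (n + 1) → ℝ), DifferentiableAt ℝ f x ∧
        ‖fderiv ℝ f x‖ ≤ (∑ μ, |C μ|) * ‖x‖ ^ m := by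
      filter_upwards [eventually_all.2 hC, h.1.eventually_differentiableAt] with x hx hd
      refine ⟨hd, ContinuousLinearMap.opNorm_le_bound _ (by positivity) fun v => ?_⟩
      have hv : fderiv ℝ f x v = ∑ μ, v μ * _root_.partialDeriv μ f x := by
        conv_lhs => rw [pi_eq_sum_univ' v]
        simp [_root_.partialDeriv, Pi.single]
      rw [hv, Finset.sum_mul, Finset.sum_mul]
      refine (norm_sum_le _ _).trans (Finset.sum_le_sum fun μ _ => ?_)
      rw [norm_mul, mul_comm]
      refine mul_le_mul ?_ (norm_le_pi_norm v μ) (norm_nonneg _) (by positivity)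
      refine (hx μ).trans ?_
      rw [norm_pow, norm_norm]
      exact mul_le_mul_of_nonneg_right (le_abs_self _) (by positivity)
    obtain ⟨r, hr, hball⟩ := Metric.eventually_nhds_iff_ball.1 hev
    refine Asymptotics.IsBigO.of_bound (∑ μ, |C μ|) ?_
    filter_upwards [Metric.ball_mem_nhds 0 hr] with x hx
    have hx' : ‖x‖ < r := by simpa using hx
    have key := (convex_closedBall (0 : Fin (n + 1) → ℝ) ‖x‖).norm_image_sub_le_of_norm_fderiv_le
      (𝕜 := ℝ) (f := f) (C := (∑ μ, |C μ|) * ‖x‖ ^ m) (x := 0) (y := x)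
      (fun y hy => (hball y (by simp at hy ⊢; linarith)).1)
      (fun y hy => (hball y (by simp at hy ⊢; linarith)).2.trans (by
        have : ‖y‖ ≤ ‖x‖ := by simpa using hy
        gcongr)) (by simp) (by simp)
    simpa [h.2.1, pow_succ, mul_assoc] using key

end VanishesToOrder

end Germs

/-! ### The algebra of smooth functions and its homogeneous elements -/

/-- The algebra of smooth functions on `ℝ^{n+1}`. -/
def smoothSubalgebra (n : ℕ) : Subalgebra ℝ ((Fin (n + 1) → ℝ) → ℝ) where
  carrier := {f | ContDiff ℝ ∞ f}
  mul_mem' {f g} (hf : ContDiff ℝ ∞ f) (hg : ContDiff ℝ ∞ g) := hf.mul hg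
  add_mem' {f g} (hf : ContDiff ℝ ∞ f) (hg : ContDiff ℝ ∞ g) := hf.add hg
  algebraMap_mem' c := show ContDiff ℝ ∞ fun _ => c from contDiff_const

/-- Smooth functions on `ℝ^{n+1}`. -/
abbrev SmoothFn (n : ℕ) : Type := smoothSubalgebra n

namespace SmoothFn

variable {n : ℕ}

theorem contDiff (f : SmoothFn n) : ContDiff ℝ ∞ f.1 := f.2

/-- The derivation `∂_μ` of the algebra of smooth functions. -/
def D (μ : Fin (n + 1)) : Derivation ℝ (SmoothFn n) (SmoothFn n) :=
  Derivation.mk'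
    { toFun := fun f => ⟨partialDeriv μ f.1,
        (f.contDiff.fderiv_right (m := ∞) (by simp)).clm_apply contDiff_const⟩
      map_add' := fun f g => Subtype.ext <| funext fun x => by
        have hf := f.contDiff.differentiable (by simp) x
        have hg := g.contDiff.differentiable (by simp) x
        simp [partialDeriv, fderiv_add hf hg]
      map_smul' := fun c f => Subtype.ext <| funext fun x => by
        have hf := f.contDiff.differentiable (by simp) x
        simp [partialDeriv, fderiv_const_smul hf c] }
    (fun f g => Subtype.ext <| funext fun x => by
        have hf := f.contDiff.differentiable (by simp) x
        have hg := g.contDiff.differentiable (by simp) x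
        simp [partialDeriv, fderiv_mul hf hg])

theorem coe_D (μ : Fin (n + 1)) (f : SmoothFn n) : (D μ f).1 = partialDeriv μ f.1 := rfl

/-- The coordinate function `x^μ`. -/
def X (μ : Fin (n + 1)) : SmoothFn n := ⟨fun x => x μ, show ContDiff ℝ ∞ _ from contDiff_apply ℝ ℝ μ⟩

theorem X_apply (μ : Fin (n + 1)) (x : Fin (n + 1) → ℝ) : (X μ).1 x = x μ := rfl

theorem D_X (μ ν : Fin (n + 1)) : D μ (X ν) = if μ = ν then 1 else 0 := by
  apply Subtype.ext
  funext x
  rw [coe_D]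
  have : fderiv ℝ (X ν).1 x = ContinuousLinearMap.proj ν :=
    (ContinuousLinearMap.proj (R := ℝ) (φ := fun _ : Fin (n + 1) => ℝ) ν).fderiv
  rw [partialDeriv, this]
  split_ifs with h
  · subst h; simp
  · simp [Ne.symm h]

theorem D_comm (μ ν : Fin (n + 1)) (f : SmoothFn n) : D μ (D ν f) = D ν (D μ f) := by
  apply Subtype.ext
  funext x
  exact partialDeriv_comm_of_contDiffAt
    (contDiffAt_infty.1 f.contDiff.contDiffAt 2) μ ν

/-- The Euler vector field `x^μ ∂_μ`. -/
def euler (n : ℕ) : Derivation ℝ (SmoothFn n) (SmoothFn n) := ∑ μ, X μ • D μ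

theorem euler_apply (f : SmoothFn n) : euler n f = ∑ μ, X μ * D μ f := by
  have h (s : Finset (Fin (n + 1))) : (∑ μ ∈ s, (X μ • D μ : Derivation ℝ _ _)) f =
      ∑ μ ∈ s, X μ * D μ f := by
    induction s using Finset.induction_on with
    | empty => simp
    | insert a s ha ih => simp [Finset.sum_insert ha, ih]
  exact h _

theorem D_euler (μ : Fin (n + 1)) (f : SmoothFn n) :
    D μ (euler n f) = D μ f + euler n (D μ f) := by
  simp [euler_apply, D_X, Finset.sum_add_distrib, D_comm μ, add_comm]

/-- `f` is homogeneous of degree `d`, in the sense of Euler's identity. -/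
def IsHomogeneous (d : ℝ) (f : SmoothFn n) : Prop := euler n f = d • f

namespace IsHomogeneous

variable {d d' : ℝ} {f g : SmoothFn n}

theorem zero (d : ℝ) : IsHomogeneous d (0 : SmoothFn n) := by simp [IsHomogeneous]

theorem add (hf : IsHomogeneous d f) (hg : IsHomogeneous d g) : IsHomogeneous d (f + g) := by
  simp_all [IsHomogeneous]

theorem smul (c : ℝ) (hf : IsHomogeneous d f) : IsHomogeneous d (c • f) := by
  simp_all [IsHomogeneous, smul_comm c d]

theorem sub (hf : IsHomogeneous d f) (hg : IsHomogeneous d g) : IsHomogeneous d (f - g) := by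
  simp_all [IsHomogeneous, smul_sub]

theorem mul (hf : IsHomogeneous d f) (hg : IsHomogeneous d' g) :
    IsHomogeneous (d + d') (f * g) := by
  simp only [IsHomogeneous] at *
  rw [Derivation.leibniz, hf, hg]
  simp only [smul_eq_mul, mul_smul_comm, add_smul, mul_comm g f]
  rw [add_comm]

theorem D (hf : IsHomogeneous d f) (μ : Fin (n + 1)) : IsHomogeneous (d - 1) (D μ f) := by
  have h := D_euler μ f
  rw [show euler n f = d • f from hf, Derivation.map_smul] at h
  simp only [IsHomogeneous, sub_smul, one_smul, h]
  abel

theorem X (μ : Fin (n + 1)) : IsHomogeneous 1 (X μ) := by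
  simp [IsHomogeneous, euler_apply, D_X]

theorem algebraMap (c : ℝ) : IsHomogeneous 0 (algebraMap ℝ (SmoothFn n) c) := by
  simp [IsHomogeneous]

theorem sum {ι : Type*} {s : Finset ι} {F : ι → SmoothFn n}
    (h : ∀ i ∈ s, IsHomogeneous d (F i)) : IsHomogeneous d (∑ i ∈ s, F i) := by
  simp only [IsHomogeneous, map_sum, Finset.smul_sum]
  exact Finset.sum_congr rfl h

/-- Euler's identity says exactly that `s ^ (-d) * f (s • x)` has zero derivative in `s > 0`;
compare `s = t` with `s = 1`. -/
theorem apply_smul (hf : IsHomogeneous d f) {t : ℝ} (ht : 0 < t) (x : Fin (n + 1) → ℝ) :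
    f.1 (t • x) = t ^ d * f.1 x := by
  have hE (y : Fin (n + 1) → ℝ) : fderiv ℝ f.1 y y = d * f.1 y := by
    have := congrFun (congrArg Subtype.val hf) y
    rw [euler_apply] at this
    conv_lhs => enter [2]; rw [pi_eq_sum_univ' y]
    simp only [map_sum, map_smul]
    simpa [SmoothFn.coe_D, partialDeriv, SmoothFn.X_apply, Pi.single, Function.update] using this
  have hder (s : ℝ) (hs : 0 < s) : HasDerivAt (fun s : ℝ => s ^ (-d) * f.1 (s • x)) 0 s := by
    have h1 := Real.hasDerivAt_rpow_const (x := s) (p := -d) (Or.inl hs.ne')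
    have h2 : HasDerivAt (fun s : ℝ => f.1 (s • x)) (fderiv ℝ f.1 (s • x) x) s :=
      (f.contDiff.differentiable (by simp) (s • x)).hasFDerivAt.comp_hasDerivAt s
        (by simpa using (hasDerivAt_id s).smul_const x)
    refine (h1.mul h2).congr_deriv ?_
    have h3 := hE (s • x)
    rw [map_smul, smul_eq_mul] at h3
    have h4 : s ^ (-d) = s ^ (-d - 1) * s := by
      rw [← Real.rpow_add_one hs.ne']; ring_nf
    rw [h4, mul_assoc (s ^ (-d - 1)) s, h3]
    ring
  have hconst : (fun s : ℝ => s ^ (-d) * f.1 (s • x)) t = (fun s : ℝ => s ^ (-d) * f.1 (s • x)) 1 :=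
    (convex_Ioi (0 : ℝ)).is_const_of_fderivWithin_eq_zero (𝕜 := ℝ)
      (fun s hs => (hder s hs).differentiableAt.differentiableWithinAt)
      (fun s hs => by
        rw [fderivWithin_of_isOpen isOpen_Ioi hs]
        ext; simpa using (hder s hs).deriv) ht (by simp)
  simp only [Real.one_rpow, one_smul, one_mul] at hconst
  rw [← hconst, ← mul_assoc, ← Real.rpow_add ht]
  simp

end IsHomogeneous

theorem vanishesToOrder_zero (f : SmoothFn n) : VanishesToOrder 0 f.1 := f.contDiff.contDiffAt

theorem vanishesToOrder_X (μ : Fin (n + 1)) : VanishesToOrder 1 (X μ).1 :=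
  ⟨(X μ).contDiff.contDiffAt, rfl, fun ν => vanishesToOrder_zero (D ν (X μ))⟩

theorem IsHomogeneous.apply_zero {d : ℝ} {f : SmoothFn n} (hf : IsHomogeneous d f) (hd : d ≠ 0) :
    f.1 0 = 0 := by
  have := congrFun (congrArg Subtype.val hf) 0
  rw [euler_apply] at this
  simpa [X_apply, hd] using this

theorem IsHomogeneous.vanishesToOrder {f : SmoothFn n} {k : ℕ} (hf : IsHomogeneous k f) :
    VanishesToOrder k f.1 := by
  induction k generalizing f with
  | zero => exact f.vanishesToOrder_zero
  | succ k ih =>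
    refine ⟨f.contDiff.contDiffAt, hf.apply_zero (by positivity), fun μ => ?_⟩
    have := hf.D μ
    rw [Nat.cast_succ, add_sub_cancel_right] at this
    exact ih this

/-- Evaluate at `t • x`: homogeneity gives `t ^ k * |f x| ≤ C * t ^ (k + 1) * ‖x‖ ^ (k + 1)`, and `t
→ 0`. This is what allows Taylor coefficients to be compared degree by degree. -/
theorem IsHomogeneous.eq_zero_of_isBigO {f : SmoothFn n} {k : ℕ} (hf : IsHomogeneous k f)
    (h : f.1 =O[𝓝 0] fun x => ‖x‖ ^ (k + 1)) : f = 0 := by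
  apply Subtype.ext
  funext x
  obtain ⟨C, hC⟩ := h.bound
  have hlim : Tendsto (fun t : ℝ => t • x) (𝓝[>] 0) (𝓝 0) := by
    have : ContinuousAt (fun t : ℝ => t • x) 0 := by fun_prop
    simpa using this.tendsto.mono_left nhdsWithin_le_nhds
  have hle : ∀ᶠ t : ℝ in 𝓝[>] 0, ‖f.1 x‖ ≤ t * (C * ‖x‖ ^ (k + 1)) := by
    filter_upwards [hlim.eventually hC, self_mem_nhdsWithin] with t h1 ht
    have ht : 0 < t := ht
    rw [hf.apply_smul ht, Real.rpow_natCast, norm_mul, norm_pow, norm_pow, norm_norm, norm_smul,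
      Real.norm_of_nonneg ht.le, mul_pow, pow_succ t] at h1
    have : t ^ k * ‖f.1 x‖ ≤ t ^ k * (t * (C * ‖x‖ ^ (k + 1))) := h1.trans (le_of_eq (by ring))
    exact le_of_mul_le_mul_left this (by positivity)
  have hlim0 : Tendsto (fun t : ℝ => t * (C * ‖x‖ ^ (k + 1))) (𝓝[>] 0) (𝓝 0) := by
    have : ContinuousAt (fun t : ℝ => t * (C * ‖x‖ ^ (k + 1))) 0 := by fun_prop
    simpa using this.tendsto.mono_left nhdsWithin_le_nhds
  simpa using ge_of_tendsto hlim0 hle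

theorem IsHomogeneous.eq_zero {f : SmoothFn n} {k : ℕ} (hf : IsHomogeneous k f)
    (h : VanishesToOrder (k + 1) f.1) : f = 0 :=
  hf.eq_zero_of_isBigO h.isBigO

end SmoothFn


open SmoothFn

/-- The leading Taylor polynomial of a function vanishing to order `m`. -/
theorem VanishesToOrder.exists_isHomogeneous {n m : ℕ} {f : (Fin (n + 1) → ℝ) → ℝ}
    (h : VanishesToOrder m f) :
    ∃ p : SmoothFn n, IsHomogeneous m p ∧ VanishesToOrder (m + 1) (fun x => f x - p.1 x) := by
  induction m generalizing f with
  | zero =>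
    refine ⟨algebraMap ℝ _ (f 0), by simpa using IsHomogeneous.algebraMap (f 0), ?_⟩
    have hs : ContDiffAt ℝ ∞ (fun x => f x - f 0) 0 := h.contDiffAt.sub contDiffAt_const
    exact ⟨hs, by simp, fun μ => hs.partialDeriv μ⟩
  | succ m ih =>
    choose q hq hfq using fun ν => ih (h.partialDeriv ν)
    -- Euler's identity recovers a form of degree `m + 1` from its gradient, here replaced by the
    -- leading parts `q ν` of `∂_ν f`.
    refine ⟨((m : ℝ) + 1)⁻¹ • ∑ ν, X ν * q ν, ?_, ?_⟩
    · refine (IsHomogeneous.sum fun ν _ => ?_).smul _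
      simpa [add_comm] using (IsHomogeneous.X ν).mul (hq ν)
    set p : SmoothFn n := ((m : ℝ) + 1)⁻¹ • ∑ ν, X ν * q ν with hp
    have hpm : VanishesToOrder (m + 1) p.1 := by
      apply IsHomogeneous.vanishesToOrder
      refine (IsHomogeneous.sum fun ν _ => ?_).smul _
      simpa [add_comm] using (IsHomogeneous.X ν).mul (hq ν)
    refine ⟨h.1.sub p.contDiff.contDiffAt, by simp [h.2.1, hpm.2.1], fun μ => ?_⟩
    have hD : D μ p = ((m : ℝ) + 1)⁻¹ • (q μ + ∑ ν, X ν * D μ (q ν)) := by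
      simp [hp, D_X, Finset.sum_add_distrib, add_comm]
    have hqD : q μ - D μ p = -(((m : ℝ) + 1)⁻¹ • ∑ ν, X ν * (D μ (q ν) - D ν (q μ))) := by
      have hE : ∑ ν, X ν * D ν (q μ) = (m : ℝ) • q μ := by rw [← euler_apply]; exact hq μ
      simp only [hD, mul_sub, Finset.sum_sub_distrib, hE]
      have hm : ((m : ℝ) + 1) ≠ 0 := by positivity
      match_scalars <;> field_simp
      ring
    -- The curl of `q` is small because `q` approximates the gradient of `f`, whose curl is zero.
    have hcomm (ν : Fin (n + 1)) :
        VanishesToOrder m (fun x => (D μ (q ν)).1 x - (D ν (q μ)).1 x) := by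
      have h1 (a b : Fin (n + 1)) : VanishesToOrder m
          (fun x => _root_.partialDeriv a (_root_.partialDeriv b f) x - (D a (q b)).1 x) :=
        ((hfq b).partialDeriv a).congr
          (partialDeriv_sub a (h.partialDeriv b).contDiffAt (q b).contDiff.contDiffAt)
      refine ((h1 ν μ).sub (h1 μ ν)).congr ?_
      filter_upwards [partialDeriv_comm h.contDiffAt μ ν] with x hx
      rw [hx]; ring
    have hqD' : VanishesToOrder (m + 1) (q μ - D μ p).1 := by
      refine ((VanishesToOrder.sum (s := Finset.univ) fun ν _ =>
        (vanishesToOrder_X ν).mul (hcomm ν)).const_mul (-((m : ℝ) + 1)⁻¹)).mono (by omega)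
        |>.congr (.of_forall fun x => ?_)
      rw [hqD]
      simp
    refine ((hfq μ).add hqD').congr ?_
    filter_upwards [partialDeriv_sub μ h.1 p.contDiff.contDiffAt] with x hx
    rw [hx, ← coe_D]
    simp

/-! ### Borel's lemma -/

/-- Converse of `isBigO` for smooth germs: as long as the order is below `m`, the leading Taylor
part is too small for its degree, hence zero. -/
theorem VanishesToOrder.of_isBigO {n m : ℕ} {f : (Fin (n + 1) → ℝ) → ℝ}
    (hf : ContDiffAt ℝ ∞ f 0) (h : f =O[𝓝 0] fun x => ‖x‖ ^ m) : VanishesToOrder m f := by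
  suffices ∀ k ≤ m, VanishesToOrder k f from this m le_rfl
  intro k hk
  induction k with
  | zero => exact hf
  | succ k ih =>
    obtain ⟨p, hp, hfp⟩ := (ih (by omega)).exists_isHomogeneous
    have hle : (fun x : Fin (n + 1) → ℝ => ‖x‖ ^ m) =O[𝓝 0] fun x => ‖x‖ ^ (k + 1) := by
      refine Asymptotics.IsBigO.of_bound 1 ?_
      filter_upwards [Metric.ball_mem_nhds (0 : Fin (n + 1) → ℝ) one_pos] with x hx
      simp only [norm_pow, norm_norm, one_mul]
      exact pow_le_pow_of_le_one (norm_nonneg _) (by simpa using (mem_ball_zero_iff.1 hx).le) hk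
    have hp0 : p = 0 := hp.eq_zero_of_isBigO
      (((h.trans hle).sub hfp.isBigO).congr_left fun x => by simp)
    simpa [hp0] using hfp

namespace SmoothFn

theorem exists_bound_iteratedFDeriv {n : ℕ} {v : (Fin (n + 1) → ℝ) → ℝ} (hv : ContDiff ℝ ∞ v)
    (hc : HasCompactSupport v) (j : ℕ) :
    ∃ C, 0 ≤ C ∧ ∀ x, ‖iteratedFDeriv ℝ j v x‖ ≤ C := by
  obtain ⟨C, hC⟩ := (hc.iteratedFDeriv (𝕜 := ℝ) j).exists_bound_of_continuous
    (hv.continuous_iteratedFDeriv (by exact_mod_cast (le_top : (j : ℕ∞) ≤ ⊤)))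
  exact ⟨C, (norm_nonneg _).trans (hC 0), hC⟩

theorem IsHomogeneous.exists_bound {n k : ℕ} {f : SmoothFn n} (hf : IsHomogeneous k f)
    (hk : k ≠ 0) : ∃ B, 0 ≤ B ∧ ∀ x, |f.1 x| ≤ ‖x‖ ^ k * B := by
  obtain ⟨B, hB⟩ := (isCompact_closedBall (0 : Fin (n + 1) → ℝ) 1).exists_bound_of_continuousOn
    f.contDiff.continuous.continuousOn
  have hB0 : 0 ≤ B := (norm_nonneg _).trans (hB 0 (by simp))
  refine ⟨B, hB0, fun x => ?_⟩
  rcases eq_or_ne x 0 with rfl | hx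
  · rw [hf.apply_zero (by exact_mod_cast hk)]
    simp [hk]
  · have hx' : 0 < ‖x‖ := norm_pos_iff.2 hx
    have h := hf.apply_smul hx' (‖x‖⁻¹ • x)
    rw [smul_smul, mul_inv_cancel₀ hx'.ne', one_smul, Real.rpow_natCast] at h
    rw [h, abs_mul, abs_of_nonneg (by positivity : 0 ≤ ‖x‖ ^ k)]
    gcongr
    exact hB _ (by simp [norm_smul, hx'.ne'])

/-- **Borel's lemma**: there is a smooth function with prescribed Taylor expansion at the
origin. -/
theorem exists_vanishesToOrder_sub_sum {n : ℕ} (f : ℕ → SmoothFn n)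
    (hf : ∀ k : ℕ, IsHomogeneous k (f k)) :
    ∃ F : SmoothFn n, ∀ m, VanishesToOrder m (F - ∑ k ∈ Finset.range m, f k).1 := by
  let χ : ContDiffBump (0 : Fin (n + 1) → ℝ) := ⟨1 / 2, 1, by norm_num, by norm_num⟩
  let v (k : ℕ) (x : Fin (n + 1) → ℝ) : ℝ := χ x * (f k).1 x
  have hv (k : ℕ) : ContDiff ℝ ∞ (v k) := χ.contDiff.mul (f k).contDiff
  have hvc (k : ℕ) : HasCompactSupport (v k) := χ.hasCompactSupport.mul_right
  choose C hC0 hC using fun k j => exists_bound_iteratedFDeriv (hv k) (hvc k) j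
  have hB' (k : ℕ) : ∃ B, 0 ≤ B ∧ (k ≠ 0 → ∀ x, |(f k).1 x| ≤ ‖x‖ ^ k * B) := by
    rcases eq_or_ne k 0 with hk | hk
    · exact ⟨0, le_rfl, fun h => absurd hk h⟩
    · obtain ⟨B, h0, h⟩ := (hf k).exists_bound hk
      exact ⟨B, h0, fun _ => h⟩
  choose B hB0 hB using hB'
  let M (k : ℕ) : ℝ := B k + ∑ j ∈ Finset.range k, C k j
  have hM0 (k : ℕ) : 0 ≤ M k := add_nonneg (hB0 k) (Finset.sum_nonneg fun j _ => hC0 k j)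
  -- The `k`-th term is cut off at scale `ε k`, chosen so that both its derivatives of order `< k`
  -- and its size relative to `‖x‖ ^ m`, `m < k`, are at most `(1 / 2) ^ k`.
  let ε (k : ℕ) : ℝ := (1 / 2) ^ k / (1 + M k)
  have hε0 (k : ℕ) : 0 < ε k := div_pos (by positivity) (by linarith [hM0 k])
  have hε1 (k : ℕ) : ε k ≤ 1 := by
    rw [div_le_one (by linarith [hM0 k])]
    have : (1 / 2 : ℝ) ^ k ≤ 1 := pow_le_one₀ (by norm_num) (by norm_num)
    linarith [hM0 k]
  have hεM (k : ℕ) {c : ℝ} (hc : c ≤ M k) : ε k * c ≤ (1 / 2) ^ k := by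
    have h1 : ε k * (1 + M k) = (1 / 2) ^ k := div_mul_cancel₀ _ (by linarith [hM0 k])
    rw [← h1]
    exact mul_le_mul_of_nonneg_left (by linarith) (hε0 k).le
  -- By homogeneity this rescaling leaves `f k` unchanged and only shrinks the support of the cutoff
  -- (`hu`), while derivatives of order `j` acquire the factor `ε k ^ (k - j)`.
  let u (k : ℕ) (x : Fin (n + 1) → ℝ) : ℝ := ε k ^ k * v k ((ε k)⁻¹ • x)
  have hu (k : ℕ) (x : Fin (n + 1) → ℝ) : u k x = χ ((ε k)⁻¹ • x) * (f k).1 x := by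
    have h := (hf k).apply_smul (inv_pos.2 (hε0 k)) x
    rw [Real.rpow_natCast, inv_pow] at h
    have hne : ε k ^ k ≠ 0 := (pow_pos (hε0 k) k).ne'
    simp only [u, v, h]
    field_simp
  have huS (k : ℕ) : ContDiff ℝ ∞ (u k) := by
    have := hv k
    fun_prop
  have hder (j k : ℕ) (hjk : j < k) (x : Fin (n + 1) → ℝ) :
      ‖iteratedFDeriv ℝ j (u k) x‖ ≤ (1 / 2) ^ k := by
    have hj : ContDiff ℝ j (v k) := contDiff_infty.1 (hv k) j
    have h1 : iteratedFDeriv ℝ j (u k) x =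
        ε k ^ k • ((ε k)⁻¹ ^ j • iteratedFDeriv ℝ j (v k) ((ε k)⁻¹ • x)) := by
      have := iteratedFDeriv_const_smul_apply' (𝕜 := ℝ) (a := ε k ^ k) (i := j)
        (f := fun x => v k ((ε k)⁻¹ • x)) (x := x) (by fun_prop)
      rw [iteratedFDeriv_comp_const_smul _ hj] at this
      exact this
    rw [h1, norm_smul, norm_smul, norm_pow, norm_pow, norm_inv, Real.norm_of_nonneg (hε0 k).le,
      ← mul_assoc]
    obtain ⟨i, rfl⟩ : ∃ i, k = j + i + 1 := ⟨k - j - 1, by omega⟩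
    set k := j + i + 1
    have h2 : ε k ^ k * (ε k)⁻¹ ^ j = ε k * ε k ^ i := by
      have : ε k ≠ 0 := (hε0 k).ne'
      have hk : ε k ^ k = ε k ^ j * ε k ^ i * ε k := by rw [← pow_add, ← pow_succ]
      rw [hk, inv_pow]
      field_simp
    rw [h2, mul_assoc]
    refine hεM k ?_
    calc ε k ^ i * ‖iteratedFDeriv ℝ j (v k) ((ε k)⁻¹ • x)‖ ≤ 1 * C k j := by
          gcongr
          · exact pow_le_one₀ (hε0 k).le (hε1 k)
          · exact hC k j _
      _ ≤ M k := by
          rw [one_mul]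
          exact (Finset.single_le_sum (f := C k) (fun j _ => hC0 k j)
            (Finset.mem_range.2 hjk)).trans (le_add_of_nonneg_left (hB0 k))
  have hsize (m k : ℕ) (hk : m < k) (x : Fin (n + 1) → ℝ) :
      ‖u k x‖ ≤ (1 / 2) ^ k * ‖x‖ ^ m := by
    rcases le_or_gt 1 ‖(ε k)⁻¹ • x‖ with hx | hx
    · rw [hu, χ.zero_of_le_dist (by simpa using hx)]
      simp only [zero_mul, norm_zero]
      positivity
    · have hxε : ‖x‖ < ε k := by
        rw [norm_smul, norm_inv, Real.norm_of_nonneg (hε0 k).le, inv_mul_lt_iff₀ (hε0 k)] at hx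
        simpa using hx
      obtain ⟨i, rfl⟩ : ∃ i, k = m + i + 1 := ⟨k - m - 1, by omega⟩
      set k := m + i + 1
      rw [hu, norm_mul, Real.norm_of_nonneg χ.nonneg]
      calc χ ((ε k)⁻¹ • x) * ‖(f k).1 x‖ ≤ 1 * (‖x‖ ^ k * B k) := by
            gcongr
            · exact χ.le_one
            · exact hB k (by omega) x
        _ = ‖x‖ * B k * ‖x‖ ^ i * ‖x‖ ^ m := by simp only [k]; ring
        _ ≤ ε k * B k * 1 * ‖x‖ ^ m := by
            have := hB0 k
            have := hε0 k
            gcongr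
            exact pow_le_one₀ (norm_nonneg _) (hxε.le.trans (hε1 k))
        _ ≤ (1 / 2) ^ k * ‖x‖ ^ m := by
            rw [mul_one]
            gcongr
            exact hεM k (le_add_of_nonneg_right (Finset.sum_nonneg fun j _ => hC0 k j))
  have hgeom : Summable fun k : ℕ => (1 / 2 : ℝ) ^ k := summable_geometric_two
  have hFS : ContDiff ℝ ∞ fun x => ∑' k, u k x := by
    refine contDiff_tsum_of_eventually huS (v := fun _ k => (1 / 2) ^ k) (fun _ _ => hgeom)
      fun j _ => ?_
    rw [Nat.cofinite_eq_atTop]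
    filter_upwards [eventually_gt_atTop j] with k hk x using hder j k hk x
  have hsum (x : Fin (n + 1) → ℝ) : Summable fun k => u k x := by
    refine .of_norm_bounded_eventually_nat hgeom ?_
    filter_upwards [eventually_gt_atTop 0] with k hk
    simpa using hsize 0 k hk x
  let F : SmoothFn n := ⟨fun x => ∑' k, u k x, hFS⟩
  refine ⟨F, fun m => ?_⟩
  -- The estimate `hsize m` requires `m < k`, so the term of degree `m` is removed as well; it
  -- vanishes to order `m` and is added back at the end.
  have htail : VanishesToOrder m (F - ∑ k ∈ Finset.range (m + 1), f k).1 := by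
    refine .of_isBigO (SmoothFn.contDiff _).contDiffAt (.of_bound (∑' k : ℕ, (1 / 2) ^ k) ?_)
    have hnear : ∀ᶠ x in 𝓝 (0 : Fin (n + 1) → ℝ), ∀ k ∈ Finset.range (m + 1),
        u k x = (f k).1 x := by
      rw [eventually_all_finset]
      intro k _
      filter_upwards [Metric.ball_mem_nhds (0 : Fin (n + 1) → ℝ)
        (show 0 < ε k * (1 / 2) by have := hε0 k; positivity)] with x hx
      rw [hu, χ.one_of_mem_closedBall, one_mul]
      rw [mem_closedBall_zero_iff, norm_smul, norm_inv, Real.norm_of_nonneg (hε0 k).le,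
        inv_mul_le_iff₀ (hε0 k)]
      exact (mem_ball_zero_iff.1 hx).le
    filter_upwards [hnear] with x hx
    have h1 : (F - ∑ k ∈ Finset.range (m + 1), f k).1 x = ∑' k, u (k + (m + 1)) x := by
      have h2 := (hsum x).sum_add_tsum_nat_add (m + 1)
      rw [Finset.sum_congr rfl hx] at h2
      have h3 : (F - ∑ k ∈ Finset.range (m + 1), f k).1 x =
          ∑' k, u k x - ∑ k ∈ Finset.range (m + 1), (f k).1 x := by
        simp [F]
      rw [h3, ← h2]
      ring
    rw [h1, norm_pow, norm_norm, ← tsum_mul_right]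
    refine tsum_of_norm_bounded (hgeom.mul_right _).hasSum fun k => ?_
    refine (hsize m _ (by omega) x).trans ?_
    gcongr ?_ * _
    exact pow_le_pow_of_le_one (by norm_num) (by norm_num) (by omega)
  have hm := htail.add (hf m).vanishesToOrder
  refine hm.congr (.of_forall fun x => ?_)
  simp only [Finset.sum_range_succ]
  simp
  ring

end SmoothFn

/-! ### The Ricci tensor near a metric which is flat to second order -/

/-- The diagonal entries of the Minkowski metric. -/
def minkowskiSign {n : ℕ} (μ : Fin (n + 1)) : ℝ :=
  (Fin.cons (-1) (fun _ => 1) : Fin (n + 1) → ℝ) μ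

section

variable {n : ℕ}

theorem minkowski_apply (μ ν : Fin (n + 1)) :
    minkowski n μ ν = if μ = ν then minkowskiSign μ else 0 := by
  simp [minkowski, Matrix.diagonal_apply, minkowskiSign]

theorem minkowskiSign_mul_self (μ : Fin (n + 1)) :
    minkowskiSign μ * minkowskiSign μ = 1 := by
  refine Fin.cases ?_ (fun i => ?_) μ <;> simp [minkowskiSign]

theorem minkowski_mul_self : minkowski n * minkowski n = 1 := by
  ext μ ν
  by_cases h : μ = ν
  · subst h
    simp [Matrix.mul_apply, minkowski_apply, minkowskiSign_mul_self]
  · simp [Matrix.mul_apply, minkowski_apply, h]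

theorem minkowski_inv : (minkowski n)⁻¹ = minkowski n :=
  Matrix.inv_eq_left_inv minkowski_mul_self

theorem minkowski_det_ne_zero : (minkowski n).det ≠ 0 := by
  have h := congrArg Matrix.det (minkowski_mul_self (n := n))
  rw [Matrix.det_mul, Matrix.det_one] at h
  exact left_ne_zero_of_mul_eq_one h

/-- `∂_μ γ_{νσ} + ∂_ν γ_{μσ} - ∂_σ γ_{μν}`. -/
def loweredChristoffel (γ : (Fin (n + 1) → ℝ) → Matrix (Fin (n + 1)) (Fin (n + 1)) ℝ)
    (σ μ ν : Fin (n + 1)) (x : Fin (n + 1) → ℝ) : ℝ :=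
  partialDeriv μ (fun y => γ y ν σ) x + partialDeriv ν (fun y => γ y μ σ) x
    - partialDeriv σ (fun y => γ y μ ν) x

/-- The linearization at the Minkowski metric of the Ricci tensor. -/
def linearizedRicci (γ : (Fin (n + 1) → ℝ) → Matrix (Fin (n + 1)) (Fin (n + 1)) ℝ)
    (μ ν : Fin (n + 1)) (x : Fin (n + 1) → ℝ) : ℝ :=
  (1 / 2) * ∑ l, minkowskiSign l *
    (partialDeriv l (partialDeriv μ fun y => γ y ν l) x
      + partialDeriv l (partialDeriv ν fun y => γ y μ l) x
      - partialDeriv l (partialDeriv l fun y => γ y μ ν) x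
      - partialDeriv ν (partialDeriv μ fun y => γ y l l) x)

/-- The components of `g` are smooth at the origin and agree with those of the Minkowski metric
to second order. -/
def IsNearFlat (g : (Fin (n + 1) → ℝ) → Matrix (Fin (n + 1)) (Fin (n + 1)) ℝ) : Prop :=
  ∀ μ ν, VanishesToOrder 2 fun x => g x μ ν - minkowski n μ ν

theorem contDiffAt_det {m : ℕ}
    {M : (Fin (n + 1) → ℝ) → Matrix (Fin m) (Fin m) ℝ}
    (hM : ∀ i j, ContDiffAt ℝ ∞ (fun x => M x i j) 0) :
    ContDiffAt ℝ ∞ (fun x => (M x).det) 0 := by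
  simp only [Matrix.det_apply]
  exact ContDiffAt.sum fun σ _ => (contDiffAt_prod fun i _ => hM _ _).const_smul _

theorem contDiffAt_matrix_inv {M : (Fin (n + 1) → ℝ) → Matrix (Fin (n + 1)) (Fin (n + 1)) ℝ}
    (hM : ∀ i j, ContDiffAt ℝ ∞ (fun x => M x i j) 0) (h0 : (M 0).det ≠ 0) (i j : Fin (n + 1)) :
    ContDiffAt ℝ ∞ (fun x => (M x)⁻¹ i j) 0 := by
  simp only [Matrix.inv_def, Ring.inverse_eq_inv', Matrix.smul_apply, smul_eq_mul,
    Matrix.adjugate_apply]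
  refine ((contDiffAt_det hM).inv h0).mul (contDiffAt_det fun a b => ?_)
  simp only [Matrix.updateRow_apply]
  split_ifs
  · exact contDiffAt_const
  · exact hM a b

namespace IsNearFlat

variable {g g' : (Fin (n + 1) → ℝ) → Matrix (Fin (n + 1)) (Fin (n + 1)) ℝ} {k : ℕ}

theorem contDiffAt (hg : IsNearFlat g) (μ ν : Fin (n + 1)) :
    ContDiffAt ℝ ∞ (fun x => g x μ ν) 0 := by
  simpa using (hg μ ν).contDiffAt.add (contDiffAt_const (c := minkowski n μ ν))

theorem apply_zero (hg : IsNearFlat g) : g 0 = minkowski n := by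
  ext μ ν
  exact sub_eq_zero.1 (hg μ ν).eq_zero

protected theorem minkowski : IsNearFlat fun _ => minkowski n := fun μ ν => by
  simpa using VanishesToOrder.zero 2

theorem of_sub (hg : IsNearFlat g)
    (h : ∀ μ ν, VanishesToOrder (k + 2) fun x => g' x μ ν - g x μ ν) : IsNearFlat g' :=
  fun μ ν => (((h μ ν).mono (by omega)).add (hg μ ν)).congr (.of_forall fun x => by simp)

theorem eventually_det_ne_zero (hg : IsNearFlat g) : ∀ᶠ x in 𝓝 0, (g x).det ≠ 0 :=
  (contDiffAt_det hg.contDiffAt).continuousAt.eventually_ne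
    (by rw [hg.apply_zero]; exact minkowski_det_ne_zero)

theorem contDiffAt_inv (hg : IsNearFlat g) (μ ν : Fin (n + 1)) :
    ContDiffAt ℝ ∞ (fun x => (g x)⁻¹ μ ν) 0 :=
  contDiffAt_matrix_inv hg.contDiffAt (by rw [hg.apply_zero]; exact minkowski_det_ne_zero) μ ν

theorem inv_sub_inv (hg : IsNearFlat g) (hg' : IsNearFlat g')
    (h : ∀ μ ν, VanishesToOrder k fun x => g' x μ ν - g x μ ν) (μ ν : Fin (n + 1)) :
    VanishesToOrder k fun x => (g' x)⁻¹ μ ν - (g x)⁻¹ μ ν := by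
  have h1 : VanishesToOrder k fun x =>
      ∑ b, ∑ a, (g' x)⁻¹ μ a * (g' x a b - g x a b) * (-(g x)⁻¹ b ν) := by
    refine .sum fun b _ => .sum fun a _ => ?_
    exact (((h a b).mul_left (hg'.contDiffAt_inv μ a)).mul_left
      (hg.contDiffAt_inv b ν).neg).congr (.of_forall fun x => by ring)
  refine h1.congr ?_
  filter_upwards [hg.eventually_det_ne_zero, hg'.eventually_det_ne_zero] with x hx hx'
  have hu : IsUnit (g' x) ↔ IsUnit (g x) := by
    simp [Matrix.isUnit_iff_isUnit_det, hx, hx']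
  have := congrFun (congrFun (Matrix.inv_sub_inv hu) μ) ν
  rw [Matrix.sub_apply] at this
  rw [this]
  simp only [Matrix.mul_apply, Matrix.sub_apply, Finset.sum_mul]
  exact Finset.sum_congr rfl fun b _ => Finset.sum_congr rfl fun a _ => by ring

protected theorem partialDeriv (hg : IsNearFlat g) (a μ ν : Fin (n + 1)) :
    VanishesToOrder 1 (partialDeriv a fun x => g x μ ν) := by
  refine ((hg μ ν).partialDeriv a).congr ?_
  filter_upwards [partialDeriv_sub a (hg.contDiffAt μ ν) (contDiffAt_const (c := _root_.minkowski n μ ν))]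
    with x hx
  simp [hx, partialDeriv_const]

protected theorem loweredChristoffel (hg : IsNearFlat g) (σ μ ν : Fin (n + 1)) :
    VanishesToOrder 1 (loweredChristoffel g σ μ ν) :=
  ((hg.partialDeriv _ _ _).add (hg.partialDeriv _ _ _)).sub (hg.partialDeriv _ _ _)

protected theorem christoffel (hg : IsNearFlat g) (l μ ν : Fin (n + 1)) :
    VanishesToOrder 1 (christoffel g l μ ν) :=
  (VanishesToOrder.sum fun σ _ =>
    (hg.loweredChristoffel σ μ ν).mul_left (hg.contDiffAt_inv l σ)).const_mul _

protected theorem ricci (hg : IsNearFlat g) (μ ν : Fin (n + 1)) : VanishesToOrder 0 (ricci g μ ν) := by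
  have hΓ := hg.christoffel
  refine (((VanishesToOrder.sum fun l _ => ?_).sub (.sum fun l _ => ?_)).add
    (.sum fun l _ => .sum fun σ _ => ?_)).sub (.sum fun l _ => .sum fun σ _ => ?_)
  · exact (hΓ _ _ _).partialDeriv _
  · exact (hΓ _ _ _).partialDeriv _
  · exact ((hΓ _ _ _).mul (hΓ _ _ _)).mono (by omega)
  · exact ((hΓ _ _ _).mul (hΓ _ _ _)).mono (by omega)

/-- Two sources of error, both of order `k + 3`: the change of the inverse metric (order `k + 2`)
times first derivatives of `g'` (order `1`), and `g⁻¹ - η⁻¹` (order `2`) times first derivatives of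
`g' - g` (order `k + 1`). -/
theorem christoffel_sub (hg : IsNearFlat g)
    (h : ∀ μ ν, VanishesToOrder (k + 2) fun x => g' x μ ν - g x μ ν) (l μ ν : Fin (n + 1)) :
    VanishesToOrder (k + 3) fun x =>
      _root_.christoffel g' l μ ν x - _root_.christoffel g l μ ν x
      - (1 / 2) * minkowskiSign l * _root_.loweredChristoffel (fun x => g' x - g x) l μ ν x := by
  have hg' := hg.of_sub h
  have hlow (σ : Fin (n + 1)) : VanishesToOrder (k + 1)
      (_root_.loweredChristoffel (fun x => g' x - g x) σ μ ν) :=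
    (((h ν σ).partialDeriv μ).add ((h μ σ).partialDeriv ν)).sub ((h μ ν).partialDeriv σ)
  have hsub : ∀ᶠ x in 𝓝 0, ∀ σ, _root_.loweredChristoffel (fun x => g' x - g x) σ μ ν x =
      _root_.loweredChristoffel g' σ μ ν x - _root_.loweredChristoffel g σ μ ν x := by
    refine eventually_all.2 fun σ => ?_
    filter_upwards [partialDeriv_sub μ (hg'.contDiffAt ν σ) (hg.contDiffAt ν σ),
      partialDeriv_sub ν (hg'.contDiffAt μ σ) (hg.contDiffAt μ σ),
      partialDeriv_sub σ (hg'.contDiffAt μ ν) (hg.contDiffAt μ ν)] with x h1 h2 h3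
    simp only [_root_.loweredChristoffel, Matrix.sub_apply, h1, h2, h3]
    ring
  have h1 : VanishesToOrder (k + 3) fun x => (1 / 2) * ∑ σ,
      (((g' x)⁻¹ l σ - (g x)⁻¹ l σ) * _root_.loweredChristoffel g' σ μ ν x
        + ((g x)⁻¹ l σ - (_root_.minkowski n)⁻¹ l σ) *
          _root_.loweredChristoffel (fun x => g' x - g x) σ μ ν x) := by
    refine (VanishesToOrder.sum fun σ _ => .add ?_ ?_).const_mul _
    · exact ((hg.inv_sub_inv hg' h l σ).mul (hg'.loweredChristoffel σ μ ν)).mono (by omega)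
    · exact ((IsNearFlat.minkowski.inv_sub_inv hg hg l σ).mul (hlow σ)).mono (by omega)
  refine h1.congr ?_
  filter_upwards [hsub] with x hx
  have hm : minkowskiSign l * _root_.loweredChristoffel (fun x => g' x - g x) l μ ν x =
      ∑ σ, _root_.minkowski n l σ * _root_.loweredChristoffel (fun x => g' x - g x) σ μ ν x := by
    simp [minkowski_apply]
  rw [mul_assoc _ (minkowskiSign l), hm, minkowski_inv]
  change _ = (1 / 2) * ∑ σ, (g' x)⁻¹ l σ * _root_.loweredChristoffel g' σ μ ν x
    - (1 / 2) * ∑ σ, (g x)⁻¹ l σ * _root_.loweredChristoffel g σ μ ν x - _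
  simp only [hx, ← mul_sub, ← Finset.sum_sub_distrib]
  congr 1
  exact Finset.sum_congr rfl fun σ _ => by ring

theorem partialDeriv_christoffel_sub (hg : IsNearFlat g)
    (h : ∀ μ ν, VanishesToOrder (k + 2) fun x => g' x μ ν - g x μ ν) (a l μ ν : Fin (n + 1)) :
    VanishesToOrder (k + 2) fun x =>
      _root_.partialDeriv a (_root_.christoffel g' l μ ν) x
        - _root_.partialDeriv a (_root_.christoffel g l μ ν) x
      - (1 / 2) * (minkowskiSign l *
        (_root_.partialDeriv a (_root_.partialDeriv μ fun y => g' y ν l - g y ν l) x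
        + _root_.partialDeriv a (_root_.partialDeriv ν fun y => g' y μ l - g y μ l) x
        - _root_.partialDeriv a (_root_.partialDeriv l fun y => g' y μ ν - g y μ ν) x)) := by
  have hg' := hg.of_sub h
  have hlow : VanishesToOrder (k + 1) (_root_.loweredChristoffel (fun x => g' x - g x) l μ ν) :=
    (((h ν l).partialDeriv μ).add ((h μ l).partialDeriv ν)).sub ((h μ ν).partialDeriv l)
  refine ((hg.christoffel_sub h l μ ν).partialDeriv a).congr ?_
  have h1 := ((h ν l).partialDeriv μ).contDiffAt
  have h2 := ((h μ l).partialDeriv ν).contDiffAt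
  have h3 := ((h μ ν).partialDeriv l).contDiffAt
  have hc := (hg.christoffel l μ ν).contDiffAt
  have hc' := (hg'.christoffel l μ ν).contDiffAt
  filter_upwards [partialDeriv_sub a (hc'.sub hc) (contDiffAt_const.mul hlow.contDiffAt),
    partialDeriv_sub a hc' hc,
    partialDeriv_mul a (contDiffAt_const (c := 1 / 2 * minkowskiSign l)) hlow.contDiffAt,
    partialDeriv_sub a (h1.add h2) h3, partialDeriv_add a h1 h2] with x e1 e2 e3 e4 e5
  refine e1.trans ?_
  rw [e3]
  refine (congrArg₂ _ e2 rfl).trans ?_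
  rw [partialDeriv_const]
  have e6 : _root_.partialDeriv a (_root_.loweredChristoffel (fun x => g' x - g x) l μ ν) x =
      _root_.partialDeriv a (_root_.partialDeriv μ fun y => g' y ν l - g y ν l) x
        + _root_.partialDeriv a (_root_.partialDeriv ν fun y => g' y μ l - g y μ l) x
        - _root_.partialDeriv a (_root_.partialDeriv l fun y => g' y μ ν - g y μ ν) x :=
    e4.trans (congrArg₂ _ e5 rfl)
  rw [e6]
  ring

/-- The Ricci tensors of `g` and `g + γ` differ by the linearized Ricci tensor of `γ`, up to
terms of the order of `γ`. -/
theorem ricci_sub (hg : IsNearFlat g)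
    (h : ∀ μ ν, VanishesToOrder (k + 2) fun x => g' x μ ν - g x μ ν) (μ ν : Fin (n + 1)) :
    VanishesToOrder (k + 2) fun x => _root_.ricci g' μ ν x - _root_.ricci g μ ν x
      - linearizedRicci (fun x => g' x - g x) μ ν x := by
  have hg' := hg.of_sub h
  have hΓ := hg.christoffel
  have hΓ' := hg'.christoffel
  have hd (l μ ν : Fin (n + 1)) : VanishesToOrder (k + 1) fun x =>
      _root_.christoffel g' l μ ν x - _root_.christoffel g l μ ν x := by
    have h1 : VanishesToOrder (k + 1) (_root_.loweredChristoffel (fun x => g' x - g x) l μ ν) :=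
      (((h ν l).partialDeriv μ).add ((h μ l).partialDeriv ν)).sub ((h μ ν).partialDeriv l)
    refine (((hg.christoffel_sub h l μ ν).mono (by omega)).add
      (h1.const_mul (1 / 2 * minkowskiSign l))).congr (.of_forall fun x => by ring)
  -- The quadratic terms do not contribute: one factor is a difference of order `k + 1`, the other a
  -- Christoffel symbol of order `1`.
  have hq (l μ ν l' μ' ν' : Fin (n + 1)) : VanishesToOrder (k + 2) fun x =>
      _root_.christoffel g' l μ ν x * _root_.christoffel g' l' μ' ν' x
        - _root_.christoffel g l μ ν x * _root_.christoffel g l' μ' ν' x :=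
    (((hd l μ ν).mul (hΓ' l' μ' ν')).add (((hΓ l μ ν).mul (hd l' μ' ν')).mono
      (k := k + 1 + 1) (by omega))).congr (.of_forall fun x => by ring)
  have key := (((VanishesToOrder.sum (s := Finset.univ) fun l _ =>
      hg.partialDeriv_christoffel_sub h l l μ ν).sub
    (.sum (s := Finset.univ) fun l _ => hg.partialDeriv_christoffel_sub h ν l μ l)).add
    (.sum (s := Finset.univ) fun l _ => .sum (s := Finset.univ) fun σ _ => hq l l σ σ μ ν)).sub
    (.sum (s := Finset.univ) fun l _ => .sum (s := Finset.univ) fun σ _ => hq l ν σ σ μ l)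
  refine key.congr (.of_forall fun x => ?_)
  simp only [_root_.ricci, linearizedRicci, Matrix.sub_apply, Finset.sum_sub_distrib, mul_sub,
    mul_add, Finset.mul_sum, Finset.sum_add_distrib]
  ring

end IsNearFlat

theorem ricci_minkowski (μ ν : Fin (n + 1)) : ricci (fun _ => minkowski n) μ ν = fun _ => 0 := by
  have h (l μ ν : Fin (n + 1)) : christoffel (fun _ => minkowski n) l μ ν = fun _ => 0 := by
    funext x
    simp [christoffel, partialDeriv_const]
  funext x
  simp [ricci, h, partialDeriv_const]

end

/-! ### The linearized Ricci tensor of a multiple of the Minkowskian quadratic form -/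

namespace SmoothFn

variable {n : ℕ}

/-- The Minkowskian quadratic form as a smooth function. -/
def Q (n : ℕ) : SmoothFn n := ∑ α, (minkowskiSign α : ℝ) • (X α * X α)

theorem Q_apply (x : Fin (n + 1) → ℝ) : (Q n).1 x = minkowskiForm x := by
  simp [Q, minkowskiForm, minkowski_apply, X_apply, mul_assoc]

theorem isHomogeneous_Q : IsHomogeneous 2 (Q n) :=
  .sum fun α _ => .smul _ (by simpa [one_add_one_eq_two] using (IsHomogeneous.X α).mul (.X α))

theorem D_Q (μ : Fin (n + 1)) : D μ (Q n) = (2 * minkowskiSign μ) • X μ := by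
  simp [Q, D_X, ← two_mul, mul_smul, two_smul]

theorem D_D_Q_mul (l μ : Fin (n + 1)) (f : SmoothFn n) :
    D l (D μ (Q n * f)) = (2 * minkowskiSign μ) • (if l = μ then f else 0)
      + (2 * minkowskiSign μ) • (X μ * D l f) + (2 * minkowskiSign l) • (X l * D μ f)
      + Q n * D l (D μ f) := by
  simp only [Derivation.leibniz, D_Q, map_add, Derivation.map_smul, smul_eq_mul, D_X,
    mul_smul_comm, mul_ite, mul_one, mul_zero]
  simp only [mul_comm (D μ f)]
  module

theorem sum_D_D_Q_mul (μ : Fin (n + 1)) (F : Fin (n + 1) → SmoothFn n) :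
    ∑ l, (minkowskiSign l : ℝ) • D l (D μ (Q n * F l)) = (2 : ℝ) • F μ
      + (2 * minkowskiSign μ) • (X μ * ∑ l, (minkowskiSign l : ℝ) • D l (F l))
      + (2 : ℝ) • ∑ l, X l * D μ (F l)
      + Q n * ∑ l, (minkowskiSign l : ℝ) • D l (D μ (F l)) := by
  have h (l : Fin (n + 1)) : (minkowskiSign l : ℝ) • D l (D μ (Q n * F l)) =
      (if l = μ then (2 : ℝ) • F l else 0)
      + (2 * minkowskiSign μ) • (X μ * (minkowskiSign l : ℝ) • D l (F l))
      + (2 : ℝ) • (X l * D μ (F l)) + Q n * (minkowskiSign l : ℝ) • D l (D μ (F l)) := by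
    rw [D_D_Q_mul]
    have h1 : (minkowskiSign l : ℝ) • (2 * minkowskiSign l) • (X l * D μ (F l)) =
        (2 : ℝ) • (X l * D μ (F l)) := by
      rw [smul_smul, mul_left_comm, minkowskiSign_mul_self, mul_one]
    have h2 : (minkowskiSign l : ℝ) • (2 * minkowskiSign μ) • (if l = μ then F l else 0) =
        if l = μ then (2 : ℝ) • F l else 0 := by
      split_ifs with h
      · rw [← h, smul_smul, mul_left_comm, minkowskiSign_mul_self, mul_one]
      · simp
    simp only [smul_add, h1, h2, mul_smul_comm]
    module
  simp only [h, Finset.sum_add_distrib, ← Finset.smul_sum, ← Finset.mul_sum]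
  simp

/-- The linearized Ricci tensor, as an operator on smooth functions. -/
def linRicci (h : Fin (n + 1) → Fin (n + 1) → SmoothFn n) (μ ν : Fin (n + 1)) : SmoothFn n :=
  (1 / 2 : ℝ) • (∑ l, (minkowskiSign l : ℝ) • D l (D μ (h ν l))
    + ∑ l, (minkowskiSign l : ℝ) • D l (D ν (h μ l))
    - ∑ l, (minkowskiSign l : ℝ) • D l (D l (h μ ν))
    - D ν (D μ (∑ l, (minkowskiSign l : ℝ) • h l l)))

theorem linRicci_apply (h : Fin (n + 1) → Fin (n + 1) → SmoothFn n) (μ ν : Fin (n + 1))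
    (x : Fin (n + 1) → ℝ) :
    (linRicci h μ ν).1 x = linearizedRicci (fun x => Matrix.of fun i j => (h i j).1 x) μ ν x := by
  simp [linRicci, linearizedRicci, coe_D, mul_add, mul_sub, Finset.sum_add_distrib,
    Finset.sum_sub_distrib]

theorem IsHomogeneous.linRicci {h : Fin (n + 1) → Fin (n + 1) → SmoothFn n} {d : ℝ}
    (hh : ∀ i j, IsHomogeneous d (h i j)) (μ ν : Fin (n + 1)) :
    IsHomogeneous (d - 1 - 1) (linRicci h μ ν) :=
  .smul _ ((((IsHomogeneous.sum fun _ _ => .smul _ (((hh _ _).D _).D _)).add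
    (.sum fun _ _ => .smul _ (((hh _ _).D _).D _))).sub
    (.sum fun _ _ => .smul _ (((hh _ _).D _).D _))).sub
    (((IsHomogeneous.sum fun _ _ => .smul _ (hh _ _)).D _).D _))

/-- The trace of `h`. -/
def tr (h : Fin (n + 1) → Fin (n + 1) → SmoothFn n) : SmoothFn n :=
  ∑ l, (minkowskiSign l : ℝ) • h l l

/-- The divergence of a vector of functions. -/
def dvg (F : Fin (n + 1) → SmoothFn n) : SmoothFn n := ∑ l, (minkowskiSign l : ℝ) • D l (F l)

/-- The contraction of `h` with the position vector. -/
def con (h : Fin (n + 1) → Fin (n + 1) → SmoothFn n) (μ : Fin (n + 1)) : SmoothFn n :=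
  ∑ ν, h μ ν * X ν

/-- Each term falls into three pieces according to how many derivatives hit `Q`. In the wave
operator, `□Q = 2 (n + 1)` and the cross term `4 x^l ∂_l h = 4 d h` give the coefficient `n + 1 + 2
d`. -/
theorem linRicci_Q_mul {h : Fin (n + 1) → Fin (n + 1) → SmoothFn n} {d : ℝ}
    (hh : ∀ i j, IsHomogeneous d (h i j)) (μ ν : Fin (n + 1)) :
    linRicci (fun i j => Q n * h i j) μ ν = h ν μ + h μ ν - ((n : ℝ) + 1 + 2 * d) • h μ ν
      - (minkowskiSign μ : ℝ) • (if ν = μ then tr h else 0)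
      + (minkowskiSign μ : ℝ) • (X μ * (dvg (h ν) - D ν (tr h)))
      + (minkowskiSign ν : ℝ) • (X ν * (dvg (h μ) - D μ (tr h)))
      + ∑ l, X l * D μ (h ν l) + ∑ l, X l * D ν (h μ l) + Q n * linRicci h μ ν := by
  have hbox : ∑ l, (minkowskiSign l : ℝ) • D l (D l (Q n * h μ ν)) =
      (2 * ((n : ℝ) + 1) + 4 * d) • h μ ν
        + Q n * ∑ l, (minkowskiSign l : ℝ) • D l (D l (h μ ν)) := by
    have h1 (l : Fin (n + 1)) : (minkowskiSign l : ℝ) • D l (D l (Q n * h μ ν)) =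
        (2 : ℝ) • h μ ν + (4 : ℝ) • (X l * D l (h μ ν))
          + Q n * (minkowskiSign l : ℝ) • D l (D l (h μ ν)) := by
      have h2 : (minkowskiSign l : ℝ) * (2 * minkowskiSign l) = 2 := by
        rw [mul_left_comm, minkowskiSign_mul_self, mul_one]
      rw [D_D_Q_mul]
      simp only [if_true, smul_add, smul_smul, h2, mul_smul_comm]
      module
    simp only [h1, Finset.sum_add_distrib, ← Finset.smul_sum, ← Finset.mul_sum, ← euler_apply]
    rw [show euler n (h μ ν) = d • h μ ν from hh μ ν]
    simp only [Finset.sum_const, Finset.card_univ, Fintype.card_fin, ← Nat.cast_smul_eq_nsmul ℝ]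
    push_cast
    module
  have htr : ∑ l, (minkowskiSign l : ℝ) • (Q n * h l l) = Q n * tr h := by
    simp [tr, Finset.mul_sum]
  rw [linRicci, sum_D_D_Q_mul, sum_D_D_Q_mul, hbox, htr, D_D_Q_mul, linRicci]
  simp only [dvg, tr, mul_add, mul_sub, mul_smul_comm]
  module

/-- After contraction with `x^ν`, Euler's identity evaluates the radial derivatives, so that modulo
`Q` only `w = con h`, the gradient of `w · x` and a multiple of `x_μ` remain. -/
theorem con_linRicci_Q_mul {h : Fin (n + 1) → Fin (n + 1) → SmoothFn n} {d : ℝ}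
    (hh : ∀ i j, IsHomogeneous d (h i j)) (hs : ∀ i j, h i j = h j i) (μ : Fin (n + 1)) :
    con (linRicci fun i j => Q n * h i j) μ = -((n : ℝ) + 1 + d) • con h μ
      + D μ (∑ ν, con h ν * X ν)
      + (minkowskiSign μ : ℝ) • (X μ * (dvg (con h) - (d + 2) • tr h))
      + Q n * (dvg (h μ) - D μ (tr h) + con (linRicci h) μ) := by
  have h1 : ∑ ν, h ν μ * X ν = con h μ := by simp [con, hs μ]
  have h2 : ∑ ν, (if ν = μ then tr h else 0) * X ν = X μ * tr h := by
    simp [mul_comm]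
  have h3 : ∑ ν, dvg (h ν) * X ν = dvg (con h) - tr h := by
    simp only [dvg, con, tr, map_sum, Derivation.leibniz, D_X, smul_eq_mul, Finset.smul_sum,
      smul_add, Finset.sum_add_distrib, Finset.sum_mul, mul_ite, mul_one, mul_zero,
      Finset.sum_ite_eq, Finset.mem_univ, if_true, add_sub_cancel_left]
    rw [Finset.sum_comm]
    simp only [smul_mul_assoc, mul_comm (X _), fun i j => hs i j]
  have h4 : ∑ ν, D ν (tr h) * X ν = d • tr h := by
    have : IsHomogeneous d (tr h) := .sum fun _ _ => .smul _ (hh _ _)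
    rw [← show euler n (tr h) = d • tr h from this, euler_apply]
    simp [mul_comm]
  have h5 : ∑ ν, (∑ l, X l * D μ (h ν l)) * X ν = D μ (∑ ν, con h ν * X ν) - (2 : ℝ) • con h μ := by
    have : ∑ ν, D μ (con h ν) * X ν = ∑ ν, (∑ l, X l * D μ (h ν l)) * X ν + con h μ := by
      simp only [con, map_sum, Derivation.leibniz, D_X, smul_eq_mul, Finset.sum_add_distrib,
        mul_ite, mul_one, mul_zero, Finset.sum_ite_eq, Finset.mem_univ, if_true, add_mul,
        fun i => hs i μ]
      rw [add_comm]
    simp only [map_sum, Derivation.leibniz, D_X, smul_eq_mul, Finset.sum_add_distrib,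
        mul_ite, mul_one, mul_zero, Finset.sum_ite_eq, Finset.mem_univ, if_true, mul_comm (X _)]
    simp only [mul_comm (X _)] at this
    rw [this]
    module
  have h6 : ∑ ν, (∑ l, X l * D ν (h μ l)) * X ν = d • con h μ := by
    have (l : Fin (n + 1)) : ∑ ν, X ν * D ν (h μ l) = d • h μ l := by
      rw [← euler_apply]; exact hh μ l
    simp only [con, Finset.smul_sum, ← smul_mul_assoc, ← this, Finset.sum_mul]
    rw [Finset.sum_comm]
    exact Finset.sum_congr rfl fun i _ => Finset.sum_congr rfl fun j _ => by ring
  have h7 : ∑ ν, (minkowskiSign ν : ℝ) • (X ν * (dvg (h μ) - D μ (tr h)) * X ν) =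
      Q n * (dvg (h μ) - D μ (tr h)) := by
    simp only [Q, Finset.sum_mul, smul_mul_assoc]
    exact Finset.sum_congr rfl fun i _ => by ring_nf
  have h8 : ∑ ν, X μ * (dvg (h ν) - D ν (tr h)) * X ν =
      X μ * (dvg (con h) - tr h - d • tr h) := by
    simp only [mul_assoc, ← Finset.mul_sum, sub_mul, Finset.sum_sub_distrib, h3, h4]
  have h9 : ∑ ν, Q n * linRicci h μ ν * X ν = Q n * con (linRicci h) μ := by
    simp only [con, Finset.mul_sum, mul_assoc]
  have h0 : ∑ ν, h μ ν * X ν = con h μ := rfl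
  rw [con]
  simp only [linRicci_Q_mul hh, add_mul, sub_mul, Finset.sum_add_distrib, Finset.sum_sub_distrib,
    h7, smul_mul_assoc, ← Finset.smul_sum, h0, h1, h2, h5, h6, h8, h9]
  simp only [mul_add, mul_sub, mul_smul_comm, smul_sub]
  module

end SmoothFn

/-! ### Solving the linearized equation modulo the quadratic form -/

namespace SmoothFn

variable {n : ℕ}

theorem IsHomogeneous.tr {h : Fin (n + 1) → Fin (n + 1) → SmoothFn n} {d : ℝ}
    (hh : ∀ i j, IsHomogeneous d (h i j)) : IsHomogeneous d (tr h) :=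
  .sum fun _ _ => .smul _ (hh _ _)

theorem IsHomogeneous.dvg {F : Fin (n + 1) → SmoothFn n} {d : ℝ}
    (hF : ∀ i, IsHomogeneous d (F i)) : IsHomogeneous (d - 1) (dvg F) :=
  .sum fun _ _ => .smul _ ((hF _).D _)

theorem IsHomogeneous.con {h : Fin (n + 1) → Fin (n + 1) → SmoothFn n} {d : ℝ}
    (hh : ∀ i j, IsHomogeneous d (h i j)) (μ : Fin (n + 1)) : IsHomogeneous (d + 1) (con h μ) :=
  .sum fun _ _ => (hh _ _).mul (.X _)

/-- A vector of homogeneous functions of degree `d + 1` is the contraction with the position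
vector of a symmetric matrix of homogeneous functions of degree `d`. -/
theorem exists_con_eq {d : ℝ} (hd : 0 < d) (w : Fin (n + 1) → SmoothFn n)
    (hw : ∀ i, IsHomogeneous (d + 1) (w i)) :
    ∃ h : Fin (n + 1) → Fin (n + 1) → SmoothFn n, (∀ i j, IsHomogeneous d (h i j)) ∧
      (∀ i j, h i j = h j i) ∧ con h = w := by
  set s : SmoothFn n := ∑ ν, w ν * X ν with hs
  have hsh : IsHomogeneous (d + 1 + 1) s := .sum fun i _ => (hw i).mul (.X i)
  -- The symmetrized gradient of `w` contracts to `d w_j + ∂_j s`; the Hessian of `s = w · x`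
  -- contracts to `(d + 1) ∂_j s`, which fixes both coefficients.
  refine ⟨fun i j => d⁻¹ • (D i (w j) + D j (w i)) - (d * (d + 1))⁻¹ • D i (D j s), fun i j => ?_,
    fun i j => ?_, ?_⟩
  · refine .sub (.smul _ (.add ?_ ?_)) (.smul _ ?_)
    · simpa using (hw j).D i
    · simpa using (hw i).D j
    · simpa using (hsh.D j).D i
  · beta_reduce
    rw [D_comm, add_comm (D i (w j))]
  · funext μ
    have h1 : ∑ ν, D μ (w ν) * X ν = D μ s - w μ := by
      simp [hs, D_X, Finset.sum_add_distrib, mul_comm]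
    have h2 : ∑ ν, D ν (w μ) * X ν = (d + 1) • w μ := by
      rw [← show euler n (w μ) = (d + 1) • w μ from hw μ, euler_apply]
      simp [mul_comm]
    have h3 : ∑ ν, D μ (D ν s) * X ν = (d + 1) • D μ s := by
      have h4 : IsHomogeneous (d + 1) (D μ s) := by simpa using hsh.D μ
      rw [← show euler n (D μ s) = (d + 1) • D μ s from h4, euler_apply]
      simp [mul_comm, D_comm μ]
    simp only [con, sub_mul, smul_mul_assoc, add_mul, Finset.sum_sub_distrib, ← Finset.smul_sum,
      Finset.sum_add_distrib, h1, h2, h3]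
    match_scalars <;> field_simp <;> ring

/-- The unknown is first `w = con h`, solving `(n + 1 + d) w - ∂(w · x) = S`, then `h` with that
contraction, and finally a multiple of `η` added to `h` to cancel the term along `x_μ`. All
multiples of `Q` go into `p`. -/
theorem exists_con_linRicci_eq (hn : 2 ≤ n) {d : ℝ} (hd : 0 < d) (S : Fin (n + 1) → SmoothFn n)
    (hS : ∀ i, IsHomogeneous (d + 1) (S i)) :
    ∃ (h : Fin (n + 1) → Fin (n + 1) → SmoothFn n) (p : Fin (n + 1) → SmoothFn n),
      (∀ i j, IsHomogeneous d (h i j)) ∧ (∀ i j, h i j = h j i) ∧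
      (∀ i, IsHomogeneous (d - 1) (p i)) ∧
      ∀ μ, con (linRicci fun i j => Q n * h i j) μ = -S μ + Q n * p μ := by
  have hn' : (2 : ℝ) ≤ n := by exact_mod_cast hn
  have hn1 : (n : ℝ) - 1 ≠ 0 := by linarith
  have hnd : (n : ℝ) + 1 + d ≠ 0 := by positivity
  have hnd2 : (d + 2) * ((n : ℝ) + 1) - 2 ≠ 0 := by nlinarith
  -- Contracting the equation for `w` with `x` gives `(n + 1 + d) - (d + 2) = n - 1` times `w · x`;
  -- this is the division that needs `n ≥ 2`.
  set s : SmoothFn n := ((n : ℝ) - 1)⁻¹ • ∑ ν, S ν * X ν with hs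
  have hsh : IsHomogeneous (d + 1 + 1) s := .smul _ (.sum fun i _ => (hS i).mul (.X i))
  set w : Fin (n + 1) → SmoothFn n := fun μ => ((n : ℝ) + 1 + d)⁻¹ • (S μ + D μ s) with hw
  have hwh (i : Fin (n + 1)) : IsHomogeneous (d + 1) (w i) :=
    .smul _ ((hS i).add (by simpa using hsh.D i))
  have hws : ∑ ν, w ν * X ν = s := by
    have h1 : ∑ ν, S ν * X ν = ((n : ℝ) - 1) • s := by
      rw [hs, smul_smul, mul_inv_cancel₀ hn1, one_smul]
    have h2 : ∑ ν, D ν s * X ν = (d + 2) • s := by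
      rw [show d + 2 = d + 1 + 1 by ring, ← show euler n s = (d + 1 + 1) • s from hsh, euler_apply]
      simp [mul_comm]
    simp only [hw, smul_mul_assoc, add_mul, ← Finset.smul_sum, Finset.sum_add_distrib, h1, h2]
    match_scalars
    field_simp
    ring
  obtain ⟨h, hh, hsym, hcon⟩ := exists_con_eq hd w hwh
  -- Adding `a η` to `h` changes the coefficient of `x_μ` by `-(n + 1 + d) + 2 + (n + 1 + d) - (d +
  -- 2) (n + 1)` times `a`, where the `2` comes from `∂_μ (Q a)`.
  set a : SmoothFn n := ((d + 2) * ((n : ℝ) + 1) - 2)⁻¹ • (dvg (con h) - (d + 2) • tr h) with ha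
  have hah : IsHomogeneous d a := by
    refine .smul _ (.sub ?_ (.smul _ (.tr hh)))
    simpa using IsHomogeneous.dvg (IsHomogeneous.con hh)
  let h' (i j : Fin (n + 1)) : SmoothFn n := h i j + (minkowskiSign i : ℝ) • if i = j then a else 0
  have hh' (i j : Fin (n + 1)) : IsHomogeneous d (h' i j) := by
    refine (hh i j).add (.smul _ ?_)
    split_ifs
    · exact hah
    · exact .zero _
  have hsym' (i j : Fin (n + 1)) : h' i j = h' j i := by
    simp only [h', hsym i j]
    by_cases hij : i = j
    · rw [hij]
    · simp [hij, Ne.symm hij]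
  have hcon' : con h' = fun μ => w μ + (minkowskiSign μ : ℝ) • (X μ * a) := by
    funext μ
    rw [← hcon]
    simp only [con, h', add_mul, Finset.sum_add_distrib]
    congr 1
    simp [mul_comm]
  have hs' : ∑ ν, con h' ν * X ν = s + Q n * a := by
    simp only [hcon', add_mul, Finset.sum_add_distrib, hws, Q, Finset.sum_mul, smul_mul_assoc]
    congr 1
    exact Finset.sum_congr rfl fun i _ => by ring_nf
  have htr' : tr h' = tr h + ((n : ℝ) + 1) • a := by
    simp only [tr, h', smul_add, Finset.sum_add_distrib, if_true, smul_smul,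
      minkowskiSign_mul_self, one_smul, Finset.sum_const, Finset.card_univ, Fintype.card_fin,
      ← Nat.cast_smul_eq_nsmul ℝ]
    push_cast
    rfl
  have hdvg' : dvg (con h') = dvg (con h) + ((n : ℝ) + 1 + d) • a := by
    have h1 (l : Fin (n + 1)) : (minkowskiSign l : ℝ) • D l ((minkowskiSign l : ℝ) • (X l * a)) =
        a + X l * D l a := by
      rw [Derivation.map_smul, smul_smul, minkowskiSign_mul_self]
      simp [D_X, add_comm]
    rw [hcon', ← hcon]
    simp only [dvg, map_add, smul_add, Finset.sum_add_distrib, h1, ← euler_apply]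
    rw [show euler n a = d • a from hah]
    simp only [Finset.sum_const, Finset.card_univ, Fintype.card_fin, ← Nat.cast_smul_eq_nsmul ℝ]
    push_cast
    module
  have hfa : dvg (con h) - (d + 2) • tr h = ((d + 2) * ((n : ℝ) + 1) - 2) • a := by
    rw [ha, smul_smul, mul_inv_cancel₀ hnd2, one_smul]
  refine ⟨h', fun μ => D μ a + (dvg (h' μ) - D μ (tr h') + con (linRicci h') μ), hh', hsym',
    fun μ => ?_, fun μ => ?_⟩
  · refine (hah.D μ).add (((IsHomogeneous.dvg (hh' μ)).sub ((IsHomogeneous.tr hh').D μ)).add ?_)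
    simpa using IsHomogeneous.con (fun i j => IsHomogeneous.linRicci hh' i j) μ
  · rw [con_linRicci_Q_mul hh' hsym', hs', hdvg', htr', hcon']
    have h1 : S μ = ((n : ℝ) + 1 + d) • w μ - D μ s := by
      simp only [hw]
      rw [smul_smul, mul_inv_cancel₀ hnd, one_smul, add_sub_cancel_right]
    have h2 : dvg (con h) + ((n : ℝ) + 1 + d) • a - (d + 2) • (tr h + ((n : ℝ) + 1) • a) =
        ((n : ℝ) - 1 + d) • a := by
      have : dvg (con h) = ((d + 2) * ((n : ℝ) + 1) - 2) • a + (d + 2) • tr h := by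
        rw [← hfa]; abel
      rw [this]
      module
    rw [h1, h2]
    simp only [map_add, Derivation.leibniz, D_Q, smul_eq_mul, mul_add, mul_smul_comm, mul_comm a]
    simp only [smul_mul_assoc]
    module

/-- For constant `h` the equation reads `(n - 1) h + η tr h = r`. Its trace is `2 n tr h = tr r`,
which gives `τ` and then `h`. -/
theorem exists_linRicci_eq_const (hn : 2 ≤ n) (r : Fin (n + 1) → Fin (n + 1) → ℝ)
    (hr : ∀ i j, r i j = r j i) :
    ∃ h : Fin (n + 1) → Fin (n + 1) → SmoothFn n,
      (∀ i j, IsHomogeneous 0 (h i j)) ∧ (∀ i j, h i j = h j i) ∧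
      ∀ μ ν, linRicci (fun i j => Q n * h i j) μ ν = algebraMap ℝ _ (-r μ ν) := by
  have hn' : (2 : ℝ) ≤ n := by exact_mod_cast hn
  have hn1 : (n : ℝ) - 1 ≠ 0 := by linarith
  set τ : ℝ := (∑ l, minkowskiSign l * r l l) / (2 * n) with hτ
  let c (i j : Fin (n + 1)) : ℝ := (r i j - minkowskiSign i * if i = j then τ else 0) / (n - 1)
  have hc : ∑ l, minkowskiSign l * c l l = τ := by
    have h1 (l : Fin (n + 1)) : (minkowskiSign l : ℝ) * c l l =
        (minkowskiSign l * r l l - τ) / (n - 1) := by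
      simp only [c, if_true, ← mul_div_assoc, mul_sub, ← mul_assoc, minkowskiSign_mul_self, one_mul]
    have h2 : ∑ l, minkowskiSign l * r l l = 2 * n * τ := by
      rw [hτ, mul_div_cancel₀]; positivity
    simp only [h1, ← Finset.sum_div, Finset.sum_sub_distrib, h2]
    simp
    field_simp
    ring
  have hsym (i j : Fin (n + 1)) : c i j = c j i := by
    simp only [c, hr i j]
    by_cases hij : i = j
    · rw [hij]
    · simp [hij, Ne.symm hij]
  have hh (i j : Fin (n + 1)) : IsHomogeneous 0 (algebraMap ℝ (SmoothFn n) (c i j)) := .algebraMap _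
  have htr : tr (fun i j => algebraMap ℝ (SmoothFn n) (c i j)) = algebraMap ℝ _ τ := by
    simp only [tr, ← hc, map_sum, map_mul, Algebra.smul_def]
  refine ⟨fun i j => algebraMap ℝ _ (c i j), hh, fun i j => by simp only [hsym i j], fun μ ν => ?_⟩
  rw [linRicci_Q_mul hh, htr]
  simp only [linRicci, dvg, Derivation.map_algebraMap, map_zero, smul_zero, Finset.sum_const_zero,
    mul_zero, add_zero, sub_zero, Derivation.map_smul, map_sum, hsym ν μ]
  have h1 : r μ ν = (n - 1) * c μ ν + minkowskiSign μ * if ν = μ then τ else 0 := by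
    simp only [c, eq_comm (a := ν)]
    field_simp
    ring
  rw [h1, Algebra.smul_def]
  split_ifs
  all_goals
    simp only [Algebra.smul_def, map_add, map_sub, map_neg, map_mul, map_natCast, map_one, map_zero]
    ring

theorem linRicci_symm {h : Fin (n + 1) → Fin (n + 1) → SmoothFn n} (hs : ∀ i j, h i j = h j i)
    (μ ν : Fin (n + 1)) : linRicci h μ ν = linRicci h ν μ := by
  rw [linRicci, linRicci, hs μ ν, D_comm μ ν]
  congr 3
  rw [add_comm]

/-- The linearized contracted Bianchi identity. -/
theorem sum_D_linRicci {h : Fin (n + 1) → Fin (n + 1) → SmoothFn n} (hs : ∀ i j, h i j = h j i)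
    (ν : Fin (n + 1)) :
    ∑ μ, (minkowskiSign μ : ℝ) • D μ (linRicci h μ ν) =
      (1 / 2 : ℝ) • D ν (∑ μ, (minkowskiSign μ : ℝ) • linRicci h μ μ) := by
  simp only [linRicci, Derivation.map_smul, map_add, map_sub, map_sum, smul_add, smul_sub,
    Finset.smul_sum, Finset.sum_add_distrib, Finset.sum_sub_distrib]
  -- This cancels the first divergence term against the wave operator term; the other two terms form
  -- half the gradient of the scalar curvature.
  have e1 : ∑ μ, ∑ l, (minkowskiSign μ : ℝ) • (1 / 2 : ℝ) • (minkowskiSign l : ℝ) •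
        D μ (D l (D μ (h ν l))) =
      ∑ μ, ∑ l, (minkowskiSign μ : ℝ) • (1 / 2 : ℝ) • (minkowskiSign l : ℝ) •
        D μ (D l (D l (h μ ν))) := by
    rw [Finset.sum_comm]
    refine Finset.sum_congr rfl fun μ _ => Finset.sum_congr rfl fun l _ => ?_
    rw [hs ν μ, D_comm l μ]
    module
  have e2 : ∑ μ, ∑ l, (minkowskiSign μ : ℝ) • (1 / 2 : ℝ) • (minkowskiSign l : ℝ) •
        D μ (D l (D ν (h μ l))) =
      ∑ μ, ∑ l, (minkowskiSign μ : ℝ) • (1 / 2 : ℝ) • (minkowskiSign l : ℝ) •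
        D ν (D l (D μ (h μ l))) := by
    refine Finset.sum_congr rfl fun μ _ => Finset.sum_congr rfl fun l _ => ?_
    rw [D_comm l ν, D_comm μ ν, D_comm μ l]
  have e3 : ∑ μ, ∑ l, (minkowskiSign μ : ℝ) • (1 / 2 : ℝ) • (minkowskiSign l : ℝ) •
        D μ (D ν (D μ (h l l))) =
      ∑ μ, ∑ l, (minkowskiSign μ : ℝ) • (1 / 2 : ℝ) • (minkowskiSign l : ℝ) •
        D ν (D l (D l (h μ μ))) := by
    rw [Finset.sum_comm]
    refine Finset.sum_congr rfl fun μ _ => Finset.sum_congr rfl fun l _ => ?_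
    rw [D_comm l ν]
    module
  have e4 : ∑ μ, ∑ l, (1 / 2 : ℝ) • (minkowskiSign μ : ℝ) • (1 / 2 : ℝ) • (minkowskiSign l : ℝ) •
        D ν (D μ (D μ (h l l))) =
      ∑ μ, ∑ l, (1 / 2 : ℝ) • (minkowskiSign μ : ℝ) • (1 / 2 : ℝ) • (minkowskiSign l : ℝ) •
        D ν (D l (D l (h μ μ))) := by
    rw [Finset.sum_comm]
    refine Finset.sum_congr rfl fun μ _ => Finset.sum_congr rfl fun l _ => ?_
    module
  rw [e1, e2, e3, e4]
  simp only [← Finset.smul_sum]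
  module

end SmoothFn

/-! ### Formal solution -/

section

variable {n : ℕ} {g : (Fin (n + 1) → ℝ) → Matrix (Fin (n + 1)) (Fin (n + 1)) ℝ}

theorem vanishesToOrder_Q : VanishesToOrder 2 (Q n).1 :=
  IsHomogeneous.vanishesToOrder (by exact_mod_cast isHomogeneous_Q)

theorem VanishesToOrder.linearizedRicci {k : ℕ}
    {γ : (Fin (n + 1) → ℝ) → Matrix (Fin (n + 1)) (Fin (n + 1)) ℝ}
    (h : ∀ i j, VanishesToOrder (k + 2) fun x => γ x i j) (μ ν : Fin (n + 1)) :
    VanishesToOrder k (linearizedRicci γ μ ν) :=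
  (VanishesToOrder.sum fun l _ => .const_mul _ ((((((h ν l).partialDeriv μ).partialDeriv l).add
    (((h μ l).partialDeriv ν).partialDeriv l)).sub
    (((h μ ν).partialDeriv l).partialDeriv l)).sub
    (((h l l).partialDeriv μ).partialDeriv ν))).const_mul _

theorem ContDiffAt.exists_vanishesToOrder_sub {f : (Fin (n + 1) → ℝ) → ℝ}
    (hf : ContDiffAt ℝ ∞ f 0) (m : ℕ) :
    ∃ p : SmoothFn n, VanishesToOrder m fun x => f x - p.1 x := by
  induction m with
  | zero => exact ⟨0, hf.sub (0 : SmoothFn n).contDiff.contDiffAt⟩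
  | succ m ih =>
    obtain ⟨p, hp⟩ := ih
    obtain ⟨q, -, hq⟩ := hp.exists_isHomogeneous
    exact ⟨p + q, hq.congr (.of_forall fun x => by simp; ring)⟩

/-- To second order, the Ricci tensor of a metric is the linearized Ricci tensor of a polynomial
perturbation. -/
theorem IsNearFlat.exists_ricci_sub_linRicci (hg : IsNearFlat g)
    (hs : ∀ᶠ x in 𝓝 0, ∀ i j, g x i j = g x j i) :
    ∃ f : Fin (n + 1) → Fin (n + 1) → SmoothFn n, (∀ i j, f i j = f j i) ∧
      ∀ μ ν, VanishesToOrder 2 fun x => ricci g μ ν x - (linRicci f μ ν).1 x := by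
  -- Order `4` is needed because two derivatives are lost. The jets are then symmetrized, so that
  -- the Bianchi identity applies to `f` exactly.
  choose q hq using fun i j => (hg i j).contDiffAt.exists_vanishesToOrder_sub 4
  let f (i j : Fin (n + 1)) : SmoothFn n := (1 / 2 : ℝ) • (q i j + q j i)
  have hm (i j : Fin (n + 1)) : minkowski n i j = minkowski n j i := by
    by_cases h : i = j
    · rw [h]
    · simp [minkowski_apply, h, Ne.symm h]
  have hf (i j : Fin (n + 1)) :
      VanishesToOrder 4 fun x => g x i j - minkowski n i j - (f i j).1 x := by
    refine (((hq i j).add (hq j i)).const_mul (1 / 2)).congr ?_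
    filter_upwards [hs] with x hx
    simp [f, hx j i, hm j i]
    ring
  let g₁ (x : Fin (n + 1) → ℝ) : Matrix (Fin (n + 1)) (Fin (n + 1)) ℝ :=
    minkowski n + Matrix.of fun i j => (f i j).1 x
  have h1 (i j : Fin (n + 1)) : VanishesToOrder (0 + 2) fun x => g₁ x i j - minkowski n i j :=
    ((hg i j).sub ((hf i j).mono (by omega))).congr (.of_forall fun x => by simp [g₁])
  have h2 (i j : Fin (n + 1)) : VanishesToOrder (2 + 2) fun x => g x i j - g₁ x i j :=
    (hf i j).congr (.of_forall fun x => by simp [g₁]; ring)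
  refine ⟨f, fun i j => by simp only [f, add_comm], fun μ ν => ?_⟩
  have e1 := IsNearFlat.minkowski.ricci_sub h1 μ ν
  have hg₁ : IsNearFlat g₁ := IsNearFlat.minkowski.of_sub h1
  have e2 := (hg₁.ricci_sub h2 μ ν).mono (k := 2) (by omega)
  have e3 := VanishesToOrder.linearizedRicci (γ := fun x => g x - g₁ x) h2 μ ν
  refine ((e1.add e2).add e3).congr (.of_forall fun x => ?_)
  simp only [ricci_minkowski, linRicci_apply, g₁, add_sub_cancel_left]
  ring

/-- The metric `g + Q h`. -/
def addQMul (g : (Fin (n + 1) → ℝ) → Matrix (Fin (n + 1)) (Fin (n + 1)) ℝ)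
    (h : Fin (n + 1) → Fin (n + 1) → SmoothFn n) (x : Fin (n + 1) → ℝ) :
    Matrix (Fin (n + 1)) (Fin (n + 1)) ℝ :=
  g x + Matrix.of fun i j => (Q n).1 x * (h i j).1 x

theorem addQMul_apply (h : Fin (n + 1) → Fin (n + 1) → SmoothFn n) (x : Fin (n + 1) → ℝ)
    (i j : Fin (n + 1)) : addQMul g h x i j = g x i j + (Q n).1 x * (h i j).1 x := rfl

protected theorem IsNearFlat.addQMul (hg : IsNearFlat g) (h : Fin (n + 1) → Fin (n + 1) → SmoothFn n) :
    IsNearFlat (addQMul g h) :=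
  hg.of_sub (k := 0) fun i j =>
    (vanishesToOrder_Q.mul (h i j).vanishesToOrder_zero).congr
      (.of_forall fun x => by simp [addQMul_apply])

theorem IsNearFlat.ricci_addQMul_add (hg : IsNearFlat g)
    (h δ : Fin (n + 1) → Fin (n + 1) → SmoothFn n) {k : ℕ}
    (hδ : ∀ i j, VanishesToOrder k (δ i j).1) (μ ν : Fin (n + 1)) :
    VanishesToOrder (k + 2) fun x => ricci (_root_.addQMul g (h + δ)) μ ν x
      - ricci (_root_.addQMul g h) μ ν x - (linRicci (fun i j => Q n * δ i j) μ ν).1 x := by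
  have hd (i j : Fin (n + 1)) : VanishesToOrder (k + 2) fun x =>
      _root_.addQMul g (h + δ) x i j - _root_.addQMul g h x i j :=
    ((vanishesToOrder_Q.mul (hδ i j)).mono (k := k + 2) (by omega)).congr
      (.of_forall fun x => by simp [addQMul_apply]; ring)
  refine ((hg.addQMul h).ricci_sub hd μ ν).congr (.of_forall fun x => ?_)
  have : (fun x => _root_.addQMul g (h + δ) x - _root_.addQMul g h x) =
      fun x => Matrix.of fun i j => (Q n * δ i j).1 x := by
    funext x
    ext i j
    simp [addQMul_apply]
    ring
  simp only [this, linRicci_apply]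

theorem vanishesToOrder_linRicci_Q_mul {δ : Fin (n + 1) → Fin (n + 1) → SmoothFn n} {k : ℕ}
    (hδ : ∀ i j, VanishesToOrder k (δ i j).1) (μ ν : Fin (n + 1)) :
    VanishesToOrder k (linRicci (fun i j => Q n * δ i j) μ ν).1 := by
  refine (VanishesToOrder.linearizedRicci
    (γ := fun x => Matrix.of fun i j => (Q n * δ i j).1 x) (fun i j => ?_) μ ν).congr
    (.of_forall fun x => (linRicci_apply _ μ ν x).symm)
  exact (vanishesToOrder_Q.mul (hδ i j)).mono (by omega)

/-- The vector `R_{μν} x^ν - Q P_μ`, where `R` is the Ricci tensor of `g + Q h`. -/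
def ricciError (g : (Fin (n + 1) → ℝ) → Matrix (Fin (n + 1)) (Fin (n + 1)) ℝ)
    (h : Fin (n + 1) → Fin (n + 1) → SmoothFn n) (P : Fin (n + 1) → SmoothFn n) (μ : Fin (n + 1))
    (x : Fin (n + 1) → ℝ) : ℝ :=
  (∑ ν, ricci (addQMul g h) μ ν x * x ν) - (P μ).1 x * (Q n).1 x

theorem IsNearFlat.ricciError_add (hg : IsNearFlat g)
    (h δ : Fin (n + 1) → Fin (n + 1) → SmoothFn n) (P p : Fin (n + 1) → SmoothFn n) {k : ℕ}
    (hδ : ∀ i j, VanishesToOrder k (δ i j).1) (μ : Fin (n + 1)) :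
    VanishesToOrder (k + 3) fun x => ricciError g (h + δ) (P + p) μ x - ricciError g h P μ x
      - (con (linRicci fun i j => Q n * δ i j) μ - Q n * p μ).1 x := by
  refine (VanishesToOrder.sum (s := Finset.univ) fun ν _ =>
    (hg.ricci_addQMul_add h δ hδ μ ν).mul (vanishesToOrder_X ν)).congr (.of_forall fun x => ?_)
  simp only [ricciError, con, X_apply, sub_mul, Finset.sum_sub_distrib]
  simp [X_apply]
  ring

theorem IsNearFlat.exists_correction (hn : 2 ≤ n) (hg : IsNearFlat g)
    (hgs : ∀ᶠ x in 𝓝 0, ∀ i j, g x i j = g x j i) (k : ℕ)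
    (H : Fin (n + 1) → Fin (n + 1) → SmoothFn n) (P : Fin (n + 1) → SmoothFn n)
    (hH : ∀ i j, H i j = H j i) (hE : ∀ μ, VanishesToOrder (k + 1) (ricciError g H P μ)) :
    ∃ (h : Fin (n + 1) → Fin (n + 1) → SmoothFn n) (p : Fin (n + 1) → SmoothFn n),
      (∀ i j, IsHomogeneous k (h i j)) ∧ (∀ i j, h i j = h j i) ∧ (k = 0 → p = 0) ∧
      (∀ i, IsHomogeneous ((k : ℝ) - 1) (p i)) ∧
      ∀ μ, VanishesToOrder (k + 2) (ricciError g (H + h) (P + p) μ) := by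
  rcases Nat.eq_zero_or_pos k with rfl | hk
  -- Degree `0`: `exists_con_eq` would divide by `d = 0`, so the full Ricci tensor at the origin is
  -- removed instead. Its symmetry there is read off from that of `linRicci f`.
  · obtain ⟨f, hfs, hf⟩ := (hg.addQMul H).exists_ricci_sub_linRicci (by
      filter_upwards [hgs] with x hx i j
      rw [addQMul_apply, addQMul_apply, hx, hH])
    have hr (i j : Fin (n + 1)) : ricci (addQMul g H) i j 0 = (linRicci f i j).1 0 :=
      sub_eq_zero.1 (hf i j).eq_zero
    obtain ⟨h, hh, hs, hlin⟩ := exists_linRicci_eq_const hn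
      (fun i j => ricci (addQMul g H) i j 0) (fun i j => by rw [hr, hr, linRicci_symm hfs])
    refine ⟨h, 0, by simpa using hh, hs, fun _ => rfl, fun _ => .zero _, fun μ => ?_⟩
    have hsub (ν : Fin (n + 1)) : VanishesToOrder 1 fun x =>
        ricci (addQMul g H) μ ν x - ricci (addQMul g H) μ ν 0 :=
      have hd := ((hg.addQMul H).ricci μ ν).contDiffAt.sub
        (contDiffAt_const (c := ricci (addQMul g H) μ ν 0))
      ⟨hd, sub_self _, fun a => hd.partialDeriv a⟩
    have e1 := VanishesToOrder.sum (s := Finset.univ) fun ν _ =>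
      (hsub ν).mul (vanishesToOrder_X ν)
    have e2 := ((P μ).vanishesToOrder_zero.mul vanishesToOrder_Q)
    have e3 := (hg.ricciError_add H h P 0 (fun i j => (h i j).vanishesToOrder_zero) μ).mono
      (k := 2) (by omega)
    refine ((e1.sub e2).add e3).congr (.of_forall fun x => ?_)
    simp only [con, hlin, sub_mul, Finset.sum_sub_distrib, ricciError, X_apply]
    simp [X_apply]
    ring
  -- `S` is the part of degree `k + 1` of the error. The correction cancels it, and its nonlinear
  -- effect is of order `k + 3`.
  · choose S hS hES using fun μ => (hE μ).exists_isHomogeneous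
    obtain ⟨h, p, hh, hs, hp, hSp⟩ := exists_con_linRicci_eq hn (d := k) (by exact_mod_cast hk) S
      (fun i => by exact_mod_cast hS i)
    refine ⟨h, p, hh, hs, fun h0 => by omega, hp, fun μ => ?_⟩
    refine ((hES μ).add ((hg.ricciError_add H h P p (fun i j => (hh i j).vanishesToOrder) μ).mono
      (k := k + 1 + 1) (by omega))).congr (.of_forall fun x => ?_)
    rw [hSp μ]
    simp

theorem IsNearFlat.exists_formal_solution (hn : 2 ≤ n) (hg : IsNearFlat g)
    (hgs : ∀ᶠ x in 𝓝 0, ∀ i j, g x i j = g x j i) :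
    ∃ (h : ℕ → Fin (n + 1) → Fin (n + 1) → SmoothFn n) (p : ℕ → Fin (n + 1) → SmoothFn n),
      (∀ (k : ℕ) i j, IsHomogeneous k (h k i j)) ∧ (∀ (k : ℕ) i j, h k i j = h k j i) ∧ p 0 = 0 ∧
      (∀ (k : ℕ) i, IsHomogeneous k (p (k + 1) i)) ∧
      ∀ m μ, VanishesToOrder (m + 1)
        (ricciError g (∑ k ∈ Finset.range m, h k) (∑ k ∈ Finset.range m, p k) μ) := by
  -- The state of the recursion carries the symmetry and the error bound that the next correction
  -- requires.
  let T (k : ℕ) := {a : (Fin (n + 1) → Fin (n + 1) → SmoothFn n) × (Fin (n + 1) → SmoothFn n) //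
    (∀ i j, a.1 i j = a.1 j i) ∧ ∀ μ, VanishesToOrder (k + 1) (ricciError g a.1 a.2 μ)}
  choose h p hh hs hp0 hp hE using fun (k : ℕ) (a : T k) =>
    hg.exists_correction hn hgs k a.1.1 a.1.2 a.2.1 a.2.2
  have h0 : ∀ μ, VanishesToOrder 1 (ricciError g 0 0 μ) := fun μ =>
    ((VanishesToOrder.sum (s := Finset.univ) fun ν _ =>
      ((hg.addQMul 0).ricci μ ν).mul (vanishesToOrder_X ν))).congr
      (.of_forall fun x => by simp [ricciError, X_apply])
  let seq (k : ℕ) : T k := Nat.rec ⟨(0, 0), fun _ _ => rfl, h0⟩ (fun k a =>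
    ⟨(a.1.1 + h k a, a.1.2 + p k a), fun i j => by simp [a.2.1 i j, hs k a i j], hE k a⟩) k
  have hseq1 (m : ℕ) : ∑ k ∈ Finset.range m, h k (seq k) = (seq m).1.1 := by
    induction m with
    | zero => rfl
    | succ m ih => rw [Finset.sum_range_succ, ih]
  have hseq2 (m : ℕ) : ∑ k ∈ Finset.range m, p k (seq k) = (seq m).1.2 := by
    induction m with
    | zero => rfl
    | succ m ih => rw [Finset.sum_range_succ, ih]
  refine ⟨fun k => h k (seq k), fun k => p k (seq k), fun k => hh k _, fun k => hs k _, hp0 0 _ rfl,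
    fun k i => by simpa using hp (k + 1) (seq (k + 1)) i, fun m μ => ?_⟩
  rw [hseq1, hseq2]
  exact (seq m).2.2 μ

end

section

variable {n : ℕ} {g : (Fin (n + 1) → ℝ) → Matrix (Fin (n + 1)) (Fin (n + 1)) ℝ}

/-! ### Vanishing of the Ricci tensor to second order -/

theorem IsNearFlat.vanishesToOrder_one_ricci (hg : IsNearFlat g) {P : Fin (n + 1) → SmoothFn n}
    (hE : ∀ μ, VanishesToOrder 2 fun x => (∑ ν, ricci g μ ν x * x ν) - (P μ).1 x * (Q n).1 x)
    (μ ν : Fin (n + 1)) : VanishesToOrder 1 (ricci g μ ν) := by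
  choose r hr hgr using fun ν => (hg.ricci μ ν).exists_isHomogeneous
  have hc : ∑ ν, r ν * X ν = 0 := by
    refine IsHomogeneous.eq_zero (k := 1) (.sum fun ν _ => ?_) ?_
    · simpa using (hr ν).mul (.X ν)
    · refine (((hE μ).add ((P μ).vanishesToOrder_zero.mul vanishesToOrder_Q)).sub
        (VanishesToOrder.sum (s := Finset.univ) fun ν _ =>
          (hgr ν).mul (vanishesToOrder_X ν))).congr (.of_forall fun x => ?_)
      simp [X_apply, sub_mul]
  have h0 : (r ν).1 0 = 0 := by
    have := congrFun (congrArg Subtype.val (congrArg (D ν) hc)) 0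
    simpa [D_X, Finset.sum_add_distrib, X_apply] using this
  refine ⟨(hg.ricci μ ν).contDiffAt, ?_, fun a => (hg.ricci μ ν).contDiffAt.partialDeriv a⟩
  simpa [h0] using (hgr ν).eq_zero

theorem IsNearFlat.vanishesToOrder_two_ricci (hg : IsNearFlat g)
    (hs : ∀ᶠ x in 𝓝 0, ∀ i j, g x i j = g x j i) {P : Fin (n + 1) → SmoothFn n}
    (hE : ∀ μ, VanishesToOrder 3 fun x => (∑ ν, ricci g μ ν x * x ν) - (P μ).1 x * (Q n).1 x)
    (μ ν : Fin (n + 1)) : VanishesToOrder 2 (ricci g μ ν) := by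
  have hR := hg.vanishesToOrder_one_ricci fun μ => (hE μ).of_succ
  choose T hT hgT using fun μ ν => (hR μ ν).exists_isHomogeneous
  obtain ⟨f, hfs, hf⟩ := hg.exists_ricci_sub_linRicci hs
  let c (μ : Fin (n + 1)) : ℝ := (P μ).1 0
  -- The coefficients are taken from `linRicci f` rather than from `T`, since symmetry and the
  -- Bianchi identity hold for it exactly; `hTt` identifies the two.
  let t (μ ν l : Fin (n + 1)) : ℝ := (D l (linRicci f μ ν)).1 0
  have hTt (μ ν l : Fin (n + 1)) : (D l (T μ ν)).1 0 = t μ ν l := by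
    have h1 : VanishesToOrder 2 (linRicci f μ ν - T μ ν).1 :=
      ((hgT μ ν).sub (hf μ ν)).congr (.of_forall fun x => by simp)
    have h2 : (D l (linRicci f μ ν - T μ ν)).1 0 = 0 := (h1.partialDeriv l).eq_zero
    rw [map_sub] at h2
    exact (sub_eq_zero.1 h2).symm
  have hc (μ : Fin (n + 1)) : ∑ ν, T μ ν * X ν - c μ • Q n = 0 := by
    refine IsHomogeneous.eq_zero (k := 2) (.sub (.sum fun ν _ => ?_) (.smul _ ?_)) ?_
    · have := (hT μ ν).mul (.X ν)
      rwa [Nat.cast_one, one_add_one_eq_two] at this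
    · exact_mod_cast isHomogeneous_Q
    · have hP : VanishesToOrder 1 fun x => (P μ).1 x - c μ :=
        have hd := (P μ).contDiff.contDiffAt.sub (contDiffAt_const (c := c μ))
        ⟨hd, sub_self _, fun a => hd.partialDeriv a⟩
      refine (((hE μ).add (hP.mul vanishesToOrder_Q)).sub
        (VanishesToOrder.sum (s := Finset.univ) fun ν _ =>
          (hgT μ ν).mul (vanishesToOrder_X ν))).congr (.of_forall fun x => ?_)
      simp [X_apply, sub_mul]
  have hrel (μ ν l : Fin (n + 1)) :
      t μ ν l + t μ l ν = 2 * minkowskiSign ν * (if ν = l then c μ else 0) := by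
    have := congrFun (congrArg Subtype.val (congrArg (D l) (congrArg (D ν) (hc μ)))) 0
    simp [D_X, Finset.sum_add_distrib, X_apply, D_Q, hTt] at this
    by_cases h : ν = l
    · rw [if_pos h.symm] at this
      simp at this
      rw [if_pos h]
      linarith
    · rw [if_neg (Ne.symm h)] at this
      simp at this
      rw [if_neg h]
      linarith
  have hsym (μ ν l : Fin (n + 1)) : t μ ν l = t ν μ l := by
    simp only [t, linRicci_symm hfs μ ν]
  -- Same permutation of indices as in the derivation of the Christoffel symbols: add two instances
  -- of `hrel` and subtract the third.
  have ht (μ ν l : Fin (n + 1)) : t μ ν l = minkowskiSign ν * (if ν = l then c μ else 0)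
      + minkowskiSign μ * (if μ = l then c ν else 0)
      - minkowskiSign μ * (if μ = ν then c l else 0) := by
    have h1 := hrel μ ν l
    have h2 := hrel ν μ l
    have h3 := hrel l μ ν
    rw [hsym ν μ, hsym ν l] at h2
    rw [hsym l μ, hsym l ν] at h3
    rw [hsym l ν] at h2
    linarith
  -- Inserting `ht`, the Bianchi identity reads `(n + 1) c_ν = c_ν - (n + 1) c_ν / 2`, that is `(3 n
  -- + 1) c_ν = 0`.
  have hc0 (ν : Fin (n + 1)) : c ν = 0 := by
    have h1 := congrFun (congrArg Subtype.val (sum_D_linRicci hfs ν)) 0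
    have h2 : ∑ μ, minkowskiSign μ * t μ ν μ = (1 / 2) * ∑ μ, minkowskiSign μ * t μ μ ν := by
      simpa [t] using h1
    simp only [ht, mul_sub, mul_add, ← mul_assoc, minkowskiSign_mul_self] at h2
    simp [Finset.sum_add_distrib, Finset.sum_sub_distrib, minkowskiSign_mul_self] at h2
    have h3 : ((n : ℝ) + 1) * c ν * 3 = 2 * c ν := by linarith
    have h4 : (3 * (n : ℝ) + 1) * c ν = 0 := by linarith
    exact (mul_eq_zero.1 h4).resolve_left (by positivity)
  have hT2 : VanishesToOrder 2 (T μ ν).1 := by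
    refine ⟨(T μ ν).contDiff.contDiffAt, (hT μ ν).apply_zero (by simp), fun l =>
      ⟨(D l (T μ ν)).contDiff.contDiffAt, ?_, fun a =>
        (D a (D l (T μ ν))).contDiff.contDiffAt⟩⟩
    have : (D l (T μ ν)).1 0 = 0 := by simp [hTt, ht, hc0]
    exact this
  exact ((hgT μ ν).add hT2).congr (.of_forall fun x => by simp)

/-! ### Stability of the Lorentzian signature -/

theorem IsLorentzianMatrix.isSymm {M : Matrix (Fin (n + 1)) (Fin (n + 1)) ℝ}
    (hM : IsLorentzianMatrix M) : M.transpose = M := by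
  obtain ⟨B, hB, h⟩ := hM
  have h' := congrArg Matrix.transpose h
  rw [Matrix.transpose_mul, Matrix.transpose_mul, Matrix.transpose_transpose, minkowski,
    Matrix.diagonal_transpose, ← minkowski, ← h, ← Matrix.mul_assoc] at h'
  have hBu : IsUnit B := (Matrix.isUnit_iff_isUnit_det B).2 hB
  have hBt : IsUnit B.transpose := (Matrix.isUnit_transpose B).2 hBu
  exact hBt.mul_left_cancel (hBu.mul_right_cancel h')

/-- `Ψ B = Bᵀ η B + (η B - (η B)ᵀ)` has derivative `Z ↦ 2 η Z` at the identity, which is onto all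
matrices, so `Ψ` covers a neighbourhood of `η`. When `Ψ B` is symmetric the antisymmetric term
vanishes and `Ψ B = Bᵀ η B`. -/
theorem eventually_isLorentzianMatrix : ∀ᶠ M : Fin (n + 1) → Fin (n + 1) → ℝ in
    𝓝 (fun i j => minkowski n i j), (∀ i j, M i j = M j i) → IsLorentzianMatrix (Matrix.of M) := by
  let Ψ (B : Fin (n + 1) → Fin (n + 1) → ℝ) (i j : Fin (n + 1)) : ℝ :=
    (∑ k, minkowskiSign k * B k i * B k j) + minkowskiSign i * B i j - minkowskiSign j * B j i
  let I (i j : Fin (n + 1)) : ℝ := if i = j then 1 else 0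
  have hΨI : Ψ I = fun i j => minkowski n i j := by
    funext i j
    by_cases h : i = j
    · subst h
      simp [Ψ, I, minkowski_apply]
    · simp [Ψ, I, minkowski_apply, h, Ne.symm h]
  have hΨ : ContDiff ℝ 1 Ψ := by
    refine contDiff_pi.2 fun i => contDiff_pi.2 fun j => ?_
    fun_prop
  have hstrict : HasStrictFDerivAt Ψ (fderiv ℝ Ψ I) I := hΨ.contDiffAt.hasStrictFDerivAt (by simp)
  have hsurj : (fderiv ℝ Ψ I).range = ⊤ := by
    refine LinearMap.range_eq_top.2 fun Y => ?_
    let Z (i j : Fin (n + 1)) : ℝ := (1 / 2) * minkowskiSign i * Y i j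
    refine ⟨Z, ?_⟩
    have h1 : HasDerivAt (fun s : ℝ => Ψ (I + s • Z)) (fderiv ℝ Ψ I Z) 0 := by
      have h2 : HasDerivAt (fun s : ℝ => I + s • Z) Z 0 := by
        simpa using ((hasDerivAt_id (0 : ℝ)).smul_const Z).const_add I
      have h3 : HasFDerivAt Ψ (fderiv ℝ Ψ I) (I + (0 : ℝ) • Z) := by
        rw [zero_smul, add_zero]
        exact hstrict.hasFDerivAt
      exact h3.comp_hasDerivAt (f := fun s : ℝ => I + s • Z) 0 h2
    have h3 : HasDerivAt (fun s : ℝ => Ψ (I + s • Z)) Y 0 := by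
      refine hasDerivAt_pi.2 fun i => hasDerivAt_pi.2 fun j => ?_
      have h4 (s : ℝ) : Ψ (I + s • Z) i j = minkowski n i j + s * Y i j
          + s ^ 2 * ∑ k, minkowskiSign k * Z k i * Z k j := by
        have h5 : ∑ k, minkowskiSign k * (I + s • Z) k i * (I + s • Z) k j =
            ∑ k, minkowskiSign k * I k i * I k j
              + s * (minkowskiSign i * Z i j) + s * (minkowskiSign j * Z j i)
              + s ^ 2 * ∑ k, minkowskiSign k * Z k i * Z k j := by
          have h6 : minkowskiSign i * Z i j = ∑ k, minkowskiSign k * I k i * Z k j := by simp [I]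
          have h7 : minkowskiSign j * Z j i = ∑ k, minkowskiSign k * Z k i * I k j := by simp [I]
          rw [h6, h7, Finset.mul_sum, Finset.mul_sum, Finset.mul_sum, ← Finset.sum_add_distrib,
            ← Finset.sum_add_distrib, ← Finset.sum_add_distrib]
          refine Finset.sum_congr rfl fun k _ => ?_
          simp only [Pi.add_apply, Pi.smul_apply, smul_eq_mul]
          ring
        have h6 : minkowskiSign i * Z i j = (1 / 2) * Y i j := by
          simp only [Z]
          linear_combination (1 / 2) * Y i j * minkowskiSign_mul_self i
        have h7 : Ψ I i j = minkowski n i j := congrFun (congrFun hΨI i) j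
        simp only [Ψ] at h7 ⊢
        rw [h5, ← h7]
        simp only [Pi.add_apply, Pi.smul_apply, smul_eq_mul]
        linear_combination 2 * s * h6
      simp only [h4]
      have h5 := (((hasDerivAt_id (0 : ℝ)).mul_const (Y i j)).const_add (minkowski n i j)).add
        (((hasDerivAt_id (0 : ℝ)).pow 2).mul_const (∑ k, minkowskiSign k * Z k i * Z k j))
      exact h5.congr_deriv (by simp)
    exact h1.unique h3
  have hmap := hstrict.map_nhds_eq_of_surj hsurj
  have hdet : ∀ᶠ B in 𝓝 I, (Matrix.of B).det ≠ 0 := by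
    have hcont : Continuous fun B : Fin (n + 1) → Fin (n + 1) → ℝ => (Matrix.of B).det :=
      Continuous.matrix_det (by exact continuous_id)
    refine hcont.continuousAt.eventually_ne ?_
    have : Matrix.of I = 1 := by ext i j; simp [I, Matrix.one_apply]
    simp [this]
  rw [← hΨI, ← hmap]
  refine Filter.eventually_map.2 ?_
  filter_upwards [hdet] with B hB hsym
  have hS (i j : Fin (n + 1)) : Ψ B i j = ∑ k, minkowskiSign k * B k i * B k j := by
    have h1 := hsym i j
    have h2 : ∑ k, minkowskiSign k * B k i * B k j = ∑ k, minkowskiSign k * B k j * B k i :=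
      Finset.sum_congr rfl fun k _ => by ring
    simp only [Ψ] at h1 ⊢
    linarith
  have hM : Matrix.of (Ψ B) = (Matrix.of B).transpose * minkowski n * Matrix.of B := by
    ext i j
    simp only [Matrix.of_apply, hS, Matrix.mul_apply, Matrix.transpose_apply, minkowski_apply]
    simp [mul_comm]
  have hu : IsUnit (Matrix.of B).det := isUnit_iff_ne_zero.2 hB
  refine ⟨(Matrix.of B)⁻¹, Matrix.isUnit_nonsing_inv_det _ hu, ?_⟩
  rw [hM, Matrix.transpose_nonsing_inv, Matrix.mul_assoc, Matrix.mul_assoc,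
    Matrix.mul_nonsing_inv _ hu, Matrix.mul_one, ← Matrix.mul_assoc,
    Matrix.nonsing_inv_mul _ (by rwa [Matrix.det_transpose]), Matrix.one_mul]

theorem IsNearFlat.eventually_isLorentzianMatrix (hg : IsNearFlat g)
    (hs : ∀ᶠ x in 𝓝 0, ∀ i j, g x i j = g x j i) : ∀ᶠ x in 𝓝 0, IsLorentzianMatrix (g x) := by
  have hlim : Tendsto (fun x i j => g x i j) (𝓝 0) (𝓝 fun i j => minkowski n i j) := by
    refine tendsto_pi_nhds.2 fun i => tendsto_pi_nhds.2 fun j => ?_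
    have := (hg.contDiffAt i j).continuousAt.tendsto
    rwa [hg.apply_zero] at this
  filter_upwards [hlim.eventually _root_.eventually_isLorentzianMatrix, hs] with x h1 h2
  exact h1 h2

/-! ### The main construction -/

theorem IsNearFlat.exists_ricciError (hn : 2 ≤ n) (hg : IsNearFlat g)
    (hgs : ∀ᶠ x in 𝓝 0, ∀ i j, g x i j = g x j i) :
    ∃ (F : Fin (n + 1) → Fin (n + 1) → SmoothFn n) (P : Fin (n + 1) → SmoothFn n),
      (∀ i j, F i j = F j i) ∧ ∀ N μ, VanishesToOrder N (ricciError g F P μ) := by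
  obtain ⟨h, p, hh, hs, hp0, hp, hE⟩ := hg.exists_formal_solution hn hgs
  choose! B hB using fun f : ℕ → SmoothFn n => exists_vanishesToOrder_sub_sum f
  refine ⟨fun i j => B fun k => h k i j, fun i => B fun k => p (k + 1) i, fun i j => ?_,
    fun N μ => ?_⟩
  -- `B` depends only on the sequence of coefficients, so the symmetry of every `h k` passes to the
  -- Borel sums.
  · simp only [hs _ i j]
  set F : Fin (n + 1) → Fin (n + 1) → SmoothFn n := fun i j => B fun k => h k i j
  set P : Fin (n + 1) → SmoothFn n := fun i => B fun k => p (k + 1) i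
  refine VanishesToOrder.mono (m := N + 2) ?_ (by omega)
  set H := ∑ k ∈ Finset.range (N + 1), h k
  set P' := ∑ k ∈ Finset.range (N + 1), p k with hP'
  have hF (i j : Fin (n + 1)) : VanishesToOrder (N + 1) ((F - H) i j).1 := by
    have := hB (fun k => h k i j) (fun k => hh k i j) (N + 1)
    simpa [F, H, Finset.sum_apply] using this
  have hP (i : Fin (n + 1)) : VanishesToOrder N ((P - P') i).1 := by
    have := hB (fun k => p (k + 1) i) (fun k => hp k i) N
    -- `p k` has degree `k - 1` and `p 0 = 0`, so `N + 1` terms of `p` are the `N` first Taylor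
    -- terms of `P`.
    rw [hP', Finset.sum_range_succ', hp0]
    simpa [P, Finset.sum_apply] using this
  have e1 := hg.ricciError_add H (F - H) P' (P - P') hF μ
  rw [add_sub_cancel, add_sub_cancel] at e1
  have e2 := VanishesToOrder.sum (s := Finset.univ) fun ν _ =>
    (vanishesToOrder_linRicci_Q_mul hF μ ν).mul (vanishesToOrder_X ν)
  have e3 := vanishesToOrder_Q.mul (hP μ)
  have e4 : VanishesToOrder (N + 2) (ricciError g H P' μ) := hE (N + 1) μ
  refine ((((e1.mono (k := N + 2) (by omega)).add e4).add e2).sub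
    (e3.mono (by omega))).congr (.of_forall fun x => ?_)
  simp [con, X_apply]
  ring

theorem VanishesToOrder.isBigOOrder {f : (Fin (n + 1) → ℝ) → ℝ} {k : ℕ∞}
    (h : ∀ N : ℕ, (N : ℕ∞) ≤ k → VanishesToOrder N f) : IsBigOOrder k f :=
  fun N hN => (h N hN).isBigO

end

end

/-! ### Assembly: the metric `g + Q F` near the origin -/

theorem lemma5p5 (n : ℕ) (hn : 2 ≤ n)
    (U : Set (Fin (n + 1) → ℝ)) (hU : IsOpen U) (h0 : (0 : Fin (n + 1) → ℝ) ∈ U)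
    (g : (Fin (n + 1) → ℝ) → Matrix (Fin (n + 1)) (Fin (n + 1)) ℝ)
    (hg : IsSmoothLorentzianMetricOn g U)
    (hcone : ∃ W : Set (Fin (n + 1) → ℝ), IsOpen W ∧ 0 ∈ W ∧ W ⊆ U ∧
      lightConeIn g W = {x | x ∈ W ∧ minkowskiForm x = 0})
    (hη : ∀ α β, IsBigOOrder 2 (fun x => g x α β - minkowski n α β))
    (ℓ : ℕ∞) :
    ∃ (V : Set (Fin (n + 1) → ℝ))
      (ghat : (Fin (n + 1) → ℝ) → Matrix (Fin (n + 1)) (Fin (n + 1)) ℝ)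
      (P : Fin (n + 1) → (Fin (n + 1) → ℝ) → ℝ),
      IsOpen V ∧ 0 ∈ V ∧ V ⊆ U ∧
      IsSmoothLorentzianMetricOn ghat V ∧
      (∀ x ∈ V, minkowskiForm x = 0 → ghat x = g x) ∧
      (∀ μ ν, IsBigOOrder (min ℓ 2) (ricci ghat μ ν)) ∧
      (∀ μ, ContDiffOn ℝ ∞ (P μ) V) ∧
      (∀ μ, IsBigOOrder (ℓ + 1)
        (fun x => (∑ ν, ricci ghat μ ν x * x ν) - P μ x * minkowskiForm x)) := by
  have hgf : IsNearFlat g := fun μ ν => .of_isBigO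
    (((hg.smooth μ ν).contDiffAt (hU.mem_nhds h0)).sub contDiffAt_const) (hη μ ν 2 le_rfl)
  have hsymU (x) (hx : x ∈ U) (i j : Fin (n + 1)) : g x i j = g x j i :=
    congrFun (congrFun (hg.lorentzian x hx).isSymm j) i
  have hgs : ∀ᶠ x in 𝓝 0, ∀ i j, g x i j = g x j i :=
    Filter.mem_of_superset (hU.mem_nhds h0) hsymU
  obtain ⟨F, P, hF, hE⟩ := hgf.exists_ricciError hn hgs
  have hGf := hgf.addQMul F
  have hGs : ∀ᶠ x in 𝓝 0, ∀ i j, addQMul g F x i j = addQMul g F x j i := by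
    filter_upwards [hgs] with x hx i j
    rw [addQMul_apply, addQMul_apply, hx, hF]
  have hsub : interior {x | x ∈ U ∧ IsLorentzianMatrix (addQMul g F x)} ⊆
      {x | x ∈ U ∧ IsLorentzianMatrix (addQMul g F x)} := interior_subset
  refine ⟨interior {x | x ∈ U ∧ IsLorentzianMatrix (addQMul g F x)}, addQMul g F,
    fun μ => (P μ).1, isOpen_interior, ?_, fun x hx => (hsub hx).1,
    ⟨fun μ ν => ?_, fun x hx => (hsub hx).2⟩, fun x _ hx => ?_, fun μ ν => ?_,
    fun μ => (P μ).contDiff.contDiffOn, fun μ => ?_⟩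
  · rw [mem_interior_iff_mem_nhds]
    exact (Filter.Eventually.and (hU.mem_nhds h0) (hGf.eventually_isLorentzianMatrix hGs))
  · exact ((hg.smooth μ ν).mono fun x hx => (hsub hx).1).add
      (SmoothFn.Q n * F μ ν).contDiff.contDiffOn
  · ext i j
    rw [addQMul_apply, SmoothFn.Q_apply, hx, zero_mul, add_zero]
  -- The error is flat, so order `3` is available and the Ricci tensor vanishes to order `2`
  -- whatever `ℓ` is.
  · have h2 := hGf.vanishesToOrder_two_ricci hGs (fun μ => hE 3 μ) μ ν
    exact VanishesToOrder.isBigOOrder fun N hN =>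
      h2.mono (by exact_mod_cast hN.trans (min_le_right _ _))
  · refine VanishesToOrder.isBigOOrder fun N _ => (hE N μ).congr (.of_forall fun x => ?_)
    simp only [ricciError, SmoothFn.Q_apply]
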